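/- For a Banach space $X$ and $1<s<\infty$ let $C_s(X)\in[0,\infty]$ denote the $\mathrm{UMD}_s$ constant of $X$: the best constant $C$ such that $$\sup_{\varepsilon_k\in\{-1,1\}}\Big\|\sum_{k=0}^n\varepsilon_k\,df_k\Big\|_{L_s(X)}\le C\,\Big\|\sum_{k=0}^n df_k\Big\|_{L_s(X)}$$ for all $n\ge 0$ and all $X$-valued martingale difference sequences $(df_k)_{k=0}^n$ in $L_s$ on probability spaces, where $df_0=f_0$ and $df_k=f_k-f_{k-1}$ ($C_s(X)=\infty$ if there is no such finite constant). Let $\mathbb T$ be the unit circle with normalised Haar measure. Let $1<p\ne q<\infty$ and $1<s<\infty$. Then there is a finite constant $\chi=\chi(p,q,s)\ge 0$, depending only on $p,q,s$, such that the following hold. (i) For every Banach space $X$, if $Y_0=X$ and $Y_{n+1}=L_p(\mathbb T;L_q(\mathbb T;Y_n))$, then for all $n\ge 0$ $$C_s(Y_n)\le\chi^n\,C_s(X).$$ (ii) If $E_0=\mathbb K$ is the scalar field ($\mathbb K=\mathbb R$ or $\mathbb C$) and $E_{n+1}=\ell_p^{(2)}(\ell_q^{(2)}(E_n))$, where $\ell_r^{(2)}(Z)$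 is $Z\times Z$ with the norm $(\|z_1\|^r+\|z_2\|^r)^{1/r}$, then for all $n\ge 1$ $$C_s(E_n)\le\chi^n,$$ that is, $C_s(E_n)$ grows at most exponentially. -/

import Mathlib

open MeasureTheory ProbabilityTheory
open scoped ENNReal NNReal

universe u

noncomputable section

/-- The difference sequence of a process, with the convention `df 0 = f 0`. -/
def martingaleDiff {Ω X : Type*} [AddCommGroup X] (f : ℕ → Ω → X) : ℕ → Ω → X
  | 0 => f 0
  | k + 1 => f (k + 1) - f k

/-- `C` is admissible in the `UMD` inequality with exponent `s`: for every probability space,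
every filtration, every `X`-valued martingale `f` in `L_s`, every `n` and every choice of signs,
`‖∑_{k ≤ n} ε_k df_k‖_{L_s(X)} ≤ C ‖∑_{k ≤ n} df_k‖_{L_s(X)}`. -/
def IsUMDBound (s : ℝ≥0∞) (X : Type*) [NormedAddCommGroup X] [NormedSpace ℝ X] [CompleteSpace X]
    (C : ℝ≥0∞) : Prop :=
  ∀ (Ω : Type) (m0 : MeasurableSpace Ω) (P : Measure Ω) (_ : IsProbabilityMeasure P)
    (ℱ : Filtration ℕ m0) (f : ℕ → Ω → X),
    Martingale f ℱ P → (∀ k, MemLp (f k) s P) →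
    ∀ (n : ℕ) (ε : ℕ → ℝ), (∀ k, ε k = 1 ∨ ε k = -1) →
      eLpNorm (fun ω => ∑ k ∈ Finset.range (n + 1), ε k • martingaleDiff f k ω) s P
        ≤ C * eLpNorm (fun ω => ∑ k ∈ Finset.range (n + 1), martingaleDiff f k ω) s P

/-- The `UMD_s` constant `C_s(X)`: the best constant in the `UMD` inequality, with value `∞` if no
finite constant is admissible. -/
def umdConst (s : ℝ≥0∞) (X : Type*) [NormedAddCommGroup X] [NormedSpace ℝ X] [CompleteSpace X] :
    ℝ≥0∞ :=
  sInf {C : ℝ≥0∞ | IsUMDBound s X C}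

/-- A Banach space together with its structure, used to define sequences of Banach spaces by
recursion. Only the real structure matters here (a complex Banach space is a real one). -/
structure BanachSp : Type (u + 1) where
  /-- The underlying type. -/
  carrier : Type u
  [normed : NormedAddCommGroup carrier]
  [space : NormedSpace ℝ carrier]
  [complete : CompleteSpace carrier]

attribute [instance] BanachSp.normed BanachSp.space BanachSp.complete

/-- The Borel σ-algebra of the unit circle. -/
instance circleMeasurableSpace : MeasurableSpace Circle := borel Circle

instance circleBorelSpace : BorelSpace Circle := ⟨rfl⟩

/-- The normalised Haar measure on the unit circle `{z : ℂ | ‖z‖ = 1}`. -/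
def circleHaar : Measure Circle := Measure.haarMeasure ⊤

instance circleHaar_isProbabilityMeasure : IsProbabilityMeasure circleHaar :=
  ⟨by simpa [circleHaar] using
    Measure.haarMeasure_self (K₀ := (⊤ : TopologicalSpace.PositiveCompacts Circle))⟩

/-- The Bochner space `L_p(𝕋; Z)`. -/
def BanachSp.LpCircle (p : ℝ≥0∞) [Fact (1 ≤ p)] (Z : BanachSp.{u}) : BanachSp.{u} :=
  ⟨Lp Z.carrier p circleHaar⟩

/-- The two-fold `ℓ_p`-sum `ℓ_p^{(2)}(Z)`: pairs in `Z` with norm `(‖z₀‖^p + ‖z₁‖^p)^{1/p}`. -/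
def BanachSp.ellTwo (p : ℝ≥0∞) [Fact (1 ≤ p)] (Z : BanachSp.{u}) : BanachSp.{u} :=
  ⟨PiLp p (fun _ : Fin 2 => Z.carrier)⟩

/-- `Y_0 = X`, `Y_{n+1} = L_p(𝕋; L_q(𝕋; Y_n))`. -/
def iterLp (p q : ℝ≥0∞) [Fact (1 ≤ p)] [Fact (1 ≤ q)] (X : BanachSp.{u}) : ℕ → BanachSp.{u}
  | 0 => X
  | n + 1 => ((iterLp p q X n).LpCircle q).LpCircle p

/-- `E_0 = X`, `E_{n+1} = ℓ_p^{(2)}(ℓ_q^{(2)}(E_n))`. -/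
def iterEll (p q : ℝ≥0∞) [Fact (1 ≤ p)] [Fact (1 ≤ q)] (X : BanachSp.{u}) : ℕ → BanachSp.{u}
  | 0 => X
  | n + 1 => ((iterEll p q X n).ellTwo q).ellTwo p

/-- The `UMD_s` constant of a bundled Banach space. -/
def BanachSp.umd (s : ℝ≥0∞) (Z : BanachSp.{u}) : ℝ≥0∞ := umdConst s Z.carrier

end

/-!
The proof rests on two facts about the `UMD` constants `C_s`.

* For equal exponents nothing is lost: `C_r(L_r(T; Z)) ≤ C_r(Z)` and `C_r(ℓ_r(Z)) ≤ C_r(Z)`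
  (`IsUMDBound.lp`, `IsUMDBound.piLp`). An `L_r(T; Z)`-valued martingale on `Ω` has a jointly
  measurable representative on `Ω × T` (`exists_isJointRep`), which is a `Z`-valued martingale for
  the filtration `ℱ k ⊗ 𝒯` (`IsJointRep.martingale`) with the same `L_r` norms. Working on the
  product avoids slicing at a fixed `t`, where uncountably many null sets would appear.
* Changing the exponent costs a factor depending on the exponents only:
  `C_s(X) ≤ c(s) C_r(X)` for all Banach spaces `X` (`umdConst_le_extrapolationConst_mul`).

Together they give `C_s(L_p(L_q(Y))) ≤ c(s) C_p(L_q(Y)) ≤ c(s) c(p) C_q(Y) ≤ c(s) c(p) c(q) C_s(Y)`,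
and similarly for `ℓ_p(ℓ_q(Y))`, and one iterates. For the scalar fields `C_2 ≤ 1` by orthogonality
of martingale differences, hence `C_s < ∞`, which is absorbed into `χ` since `n ≥ 1`.

The change of exponent is Burkholder's. Suppose the increments of `f` are dominated by an increasing
adapted process, `‖df_{k+1}‖ ≤ w_k`, and let `g` be the sign transform of `f`. Applying the `UMD_r`
inequality to the part of `f` between the first passages of `‖g‖` above `t` and `3 t`, stopped
once `f` or `w` exceeds `δ t`, gives the good-`λ` inequality
`P(g* > 3 t) ≤ P(f* ∨ w > δ t) + (3 C δ)^r P(g* > t)` (`measure_lt_maxNorm_signTransform_le`). With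
`δ` of order `1 / C` it integrates to `‖g*‖_s ≤ c C ‖f* ∨ w‖_s`. A general martingale is reduced to
this situation by Davis' decomposition (`exists_davis_decomposition`), whose remainder is controlled
by the inequality dual to Doob's (`eLpNorm_compensator_le`); Doob's maximal inequality
(`eLpNorm_maxNorm_le`) returns from `f*` to `f`.
-/

/-! ### Running maxima and Doob's inequality -/

/-- The running maximum `max_{k ≤ n} ‖f k ω‖` of the norms of a process. -/
def maxNorm {Ω X : Type*} [NormedAddCommGroup X] (f : ℕ → Ω → X) : ℕ → Ω → ℝ
  | 0 => fun ω => ‖f 0 ω‖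
  | k + 1 => fun ω => max (maxNorm f k ω) ‖f (k + 1) ω‖

section MaxNorm

variable {Ω X : Type*} [NormedAddCommGroup X] {f : ℕ → Ω → X}

theorem maxNorm_mono (f : ℕ → Ω → X) (ω : Ω) : Monotone fun n => maxNorm f n ω :=
  monotone_nat_of_le_succ fun _ => le_max_left _ _

theorem norm_le_maxNorm (f : ℕ → Ω → X) {k n : ℕ} (h : k ≤ n) (ω : Ω) :
    ‖f k ω‖ ≤ maxNorm f n ω := by
  refine le_trans ?_ (maxNorm_mono f ω h)
  cases k with
  | zero => exact le_rfl
  | succ k => exact le_max_right _ _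

theorem maxNorm_nonneg (f : ℕ → Ω → X) (n : ℕ) (ω : Ω) : 0 ≤ maxNorm f n ω :=
  (norm_nonneg _).trans (norm_le_maxNorm f (Nat.zero_le n) ω)

theorem maxNorm_le {n : ℕ} {ω : Ω} {c : ℝ} (h : ∀ k ≤ n, ‖f k ω‖ ≤ c) : maxNorm f n ω ≤ c := by
  induction n with
  | zero => exact h 0 le_rfl
  | succ n ih => exact max_le (ih fun k hk => h k (hk.trans n.le_succ)) (h _ le_rfl)

theorem maxNorm_eq_sup' (f : ℕ → Ω → X) (n : ℕ) (ω : Ω) :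
    (Finset.range (n + 1)).sup' Finset.nonempty_range_add_one (fun k => ‖f k ω‖)
      = maxNorm f n ω := by
  refine le_antisymm (Finset.sup'_le _ _ fun k hk => ?_) (maxNorm_le fun k hk => ?_)
  · exact norm_le_maxNorm f (by simpa [Nat.lt_succ_iff] using hk) ω
  · exact Finset.le_sup' (fun k => ‖f k ω‖) (by simpa [Nat.lt_succ_iff] using hk)

theorem maxNorm_stronglyAdapted {m0 : MeasurableSpace Ω} {ℱ : Filtration ℕ m0}
    (hf : StronglyAdapted ℱ f) : StronglyAdapted ℱ (maxNorm f) := by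
  intro n
  induction n with
  | zero => exact (hf 0).norm
  | succ n ih =>
    have h := ih.mono (ℱ.mono n.le_succ)
    exact @StronglyMeasurable.sup Ω ℝ _ _ (ℱ (n + 1)) _ _ _ h (hf (n + 1)).norm

theorem memLp_maxNorm {m0 : MeasurableSpace Ω} {P : Measure Ω} {s : ℝ≥0∞}
    (hf : ∀ k, MemLp (f k) s P) (n : ℕ) : MemLp (maxNorm f n) s P := by
  induction n with
  | zero => exact (hf 0).norm
  | succ n ih => exact ih.sup (hf (n + 1)).norm

theorem sum_range_martingaleDiff {Ω X : Type*} [AddCommGroup X] (f : ℕ → Ω → X) (n : ℕ) (ω : Ω) :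
    ∑ k ∈ Finset.range (n + 1), martingaleDiff f k ω = f n ω := by
  induction n with
  | zero => simp [martingaleDiff]
  | succ n ih => rw [Finset.sum_range_succ, ih]; simp [martingaleDiff]

theorem maxNorm_martingaleDiff_le (f : ℕ → Ω → X) (n : ℕ) (ω : Ω) :
    maxNorm (martingaleDiff f) n ω ≤ 2 * maxNorm f n ω := by
  refine maxNorm_le fun k hk => ?_
  cases k with
  | zero =>
    have := norm_le_maxNorm f hk ω
    have := maxNorm_nonneg f n ω
    simp only [martingaleDiff]; linarith
  | succ k =>
    have h1 := norm_le_maxNorm f hk ω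
    have h2 := norm_le_maxNorm f (k.le_succ.trans hk) ω
    have h3 := norm_sub_le (f (k + 1) ω) (f k ω)
    simp only [martingaleDiff, Pi.sub_apply]; linarith

theorem martingaleDiff_stronglyAdapted {m0 : MeasurableSpace Ω} {ℱ : Filtration ℕ m0}
    (hf : StronglyAdapted ℱ f) : StronglyAdapted ℱ (martingaleDiff f) := by
  intro n
  cases n with
  | zero => exact hf 0
  | succ n => exact (hf (n + 1)).sub ((hf n).mono (ℱ.mono n.le_succ))

theorem memLp_martingaleDiff {m0 : MeasurableSpace Ω} {P : Measure Ω} {s : ℝ≥0∞}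
    (hf : ∀ k, MemLp (f k) s P) (n : ℕ) : MemLp (martingaleDiff f n) s P := by
  cases n with
  | zero => exact hf 0
  | succ n => exact (hf (n + 1)).sub (hf n)

end MaxNorm

section Integral

variable {Ω : Type*} {m0 : MeasurableSpace Ω} {P : Measure Ω}

theorem one_lt_toReal {s : ℝ≥0∞} (hs : 1 < s) (hs' : s < ∞) : 1 < s.toReal := by
  simpa using (ENNReal.toReal_lt_toReal ENNReal.one_ne_top hs'.ne).2 hs

/-- An estimate `∫ u^σ ≤ c ∫ v u^(σ-1)` self-improves, by Hölder's inequality, to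
`‖u‖_σ ≤ c ‖v‖_σ`, provided that the left-hand side is finite. -/
theorem lintegral_rpow_le_of_le_mul_lintegral {σ : ℝ} (hσ : 1 < σ) {u v : Ω → ℝ≥0∞}
    (hu : AEMeasurable u P) (hv : AEMeasurable v P) {c : ℝ≥0∞}
    (hfin : ∫⁻ ω, u ω ^ σ ∂P ≠ ∞)
    (h : ∫⁻ ω, u ω ^ σ ∂P ≤ c * ∫⁻ ω, v ω * u ω ^ (σ - 1) ∂P) :
    (∫⁻ ω, u ω ^ σ ∂P) ^ (1 / σ) ≤ c * (∫⁻ ω, v ω ^ σ ∂P) ^ (1 / σ) := by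
  have hc : σ.HolderConjugate (σ / (σ - 1)) := Real.HolderConjugate.conjExponent hσ
  have hσ0 : (0 : ℝ) < σ := by linarith
  have hσ1 : (0 : ℝ) < σ - 1 := by linarith
  set I := ∫⁻ ω, u ω ^ σ ∂P with hI
  rcases eq_or_ne I 0 with h0 | h0
  · rw [h0, ENNReal.zero_rpow_of_pos (by positivity)]; exact zero_le
  have hH := ENNReal.lintegral_mul_le_Lp_mul_Lq P hc hv (hu.pow_const (σ - 1))
  simp only [Pi.mul_apply] at hH
  have e1 : ∀ ω, (u ω ^ (σ - 1)) ^ (σ / (σ - 1)) = u ω ^ σ := fun ω => by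
    rw [← ENNReal.rpow_mul]; congr 1; field_simp
  simp only [e1, ← hI] at hH
  have h2 : I ≤ c * (∫⁻ ω, v ω ^ σ ∂P) ^ (1 / σ) * I ^ (1 / (σ / (σ - 1))) := by
    rw [mul_assoc]; exact h.trans (mul_le_mul_right hH _)
  have e2 : I = I ^ (1 / σ) * I ^ (1 / (σ / (σ - 1))) := by
    rw [← ENNReal.rpow_add _ _ h0 hfin]
    conv_lhs => rw [← ENNReal.rpow_one I]
    congr 1; field_simp; ring
  nth_rw 1 [e2] at h2
  have hne : I ^ (1 / (σ / (σ - 1))) ≠ 0 := by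
    simp [ENNReal.rpow_eq_zero_iff, h0, hfin]
  have hne' : I ^ (1 / (σ / (σ - 1))) ≠ ∞ :=
    ENNReal.rpow_ne_top_of_nonneg (by positivity) hfin
  exact (ENNReal.mul_le_mul_iff_left hne hne').1 h2

theorem eLpNorm_eq_lintegral_ofReal {s : ℝ≥0∞} (hs : 1 < s) (hs' : s < ∞) {u : Ω → ℝ}
    (hu : ∀ ω, 0 ≤ u ω) :
    eLpNorm u s P = (∫⁻ ω, ENNReal.ofReal (u ω) ^ s.toReal ∂P) ^ (1 / s.toReal) := by
  rw [eLpNorm_eq_lintegral_rpow_enorm_toReal (by positivity) hs'.ne]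
  simp only [Real.enorm_of_nonneg (hu _)]

theorem lintegral_ofReal_rpow_ne_top {s : ℝ≥0∞} (hs : 1 < s) (hs' : s < ∞) {u : Ω → ℝ}
    (hu : ∀ ω, 0 ≤ u ω) (h : MemLp u s P) :
    ∫⁻ ω, ENNReal.ofReal (u ω) ^ s.toReal ∂P ≠ ∞ := by
  have := lintegral_rpow_enorm_lt_top_of_eLpNorm_lt_top (by positivity) hs'.ne h.2
  simpa only [Real.enorm_of_nonneg (hu _)] using this.ne

theorem eLpNorm_le_of_lintegral_le_mul {s : ℝ≥0∞} (hs : 1 < s) (hs' : s < ∞) {u v : Ω → ℝ}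
    (hu0 : ∀ ω, 0 ≤ u ω) (hv0 : ∀ ω, 0 ≤ v ω) (hu : MemLp u s P) (hv : AEMeasurable v P) {c : ℝ≥0∞}
    (h : ∫⁻ ω, ENNReal.ofReal (u ω) ^ s.toReal ∂P
      ≤ c * ∫⁻ ω, ENNReal.ofReal (v ω) * ENNReal.ofReal (u ω) ^ (s.toReal - 1) ∂P) :
    eLpNorm u s P ≤ c * eLpNorm v s P := by
  rw [eLpNorm_eq_lintegral_ofReal hs hs' hu0, eLpNorm_eq_lintegral_ofReal hs hs' hv0]
  exact lintegral_rpow_le_of_le_mul_lintegral (one_lt_toReal hs hs')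
    hu.1.aemeasurable.ennreal_ofReal hv.ennreal_ofReal
    (lintegral_ofReal_rpow_ne_top hs hs' hu0 hu) h

/-- The layer cake formula turns a weak-type bound `t P(t ≤ u) ≤ ∫_{t ≤ u} v` into
`∫ u^σ ≤ σ / (σ - 1) ∫ v u^(σ-1)`: the right-hand side is itself a layer cake integral, for the
measure with density `v`. -/
theorem lintegral_rpow_le_of_weak_type {σ : ℝ} (hσ : 1 < σ) {u : Ω → ℝ} {v : Ω → ℝ≥0∞}
    (hu0 : ∀ ω, 0 ≤ u ω) (hu : Measurable u) (hv : Measurable v)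
    (h : ∀ t : ℝ, 0 < t → ENNReal.ofReal t * P {ω | t ≤ u ω} ≤ ∫⁻ ω in {ω | t ≤ u ω}, v ω ∂P) :
    ∫⁻ ω, ENNReal.ofReal (u ω) ^ σ ∂P
      ≤ ENNReal.ofReal (σ / (σ - 1)) * ∫⁻ ω, v ω * ENNReal.ofReal (u ω) ^ (σ - 1) ∂P := by
  have hσ0 : (0 : ℝ) < σ := by linarith
  have hσ1 : (0 : ℝ) < σ - 1 := by linarith
  have L1 := lintegral_rpow_eq_lintegral_meas_le_mul P (ae_of_all _ hu0) hu.aemeasurable hσ0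
  have L2 := lintegral_rpow_eq_lintegral_meas_le_mul (P.withDensity v) (ae_of_all _ hu0)
    hu.aemeasurable hσ1
  rw [lintegral_withDensity_eq_lintegral_mul _ hv (by fun_prop)] at L2
  simp only [Pi.mul_apply] at L2
  simp only [← ENNReal.ofReal_rpow_of_nonneg (hu0 _) hσ0.le] at L1
  simp only [← ENNReal.ofReal_rpow_of_nonneg (hu0 _) hσ1.le] at L2
  rw [L1, L2, ← mul_assoc, ← ENNReal.ofReal_mul (by positivity), div_mul_cancel₀ _ hσ1.ne']
  refine mul_le_mul_right ?_ _
  refine setLIntegral_mono' measurableSet_Ioi fun t (ht : 0 < t) => ?_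
  rw [withDensity_apply _ (measurableSet_le measurable_const hu)]
  have e : t ^ (σ - 1) = t * t ^ (σ - 1 - 1) := by
    conv_lhs => rw [show σ - 1 = 1 + (σ - 1 - 1) by ring, Real.rpow_add ht, Real.rpow_one]
  rw [e, ENNReal.ofReal_mul ht.le, ← mul_assoc, mul_comm (P _)]
  gcongr
  exact h t ht

end Integral

section Doob

variable {Ω X : Type*} {m0 : MeasurableSpace Ω} {P : Measure Ω}
  [NormedAddCommGroup X] [NormedSpace ℝ X] [CompleteSpace X] {ℱ : Filtration ℕ m0}
  {f : ℕ → Ω → X}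

theorem submartingale_norm (hf : Martingale f ℱ P) :
    Submartingale (fun n ω => ‖f n ω‖) ℱ P := by
  refine ⟨fun n => (hf.1 n).norm, fun i j hij => ?_, fun n => (hf.integrable n).norm⟩
  filter_upwards [hf.2 i j hij, norm_condExp_le (μ := P) (m := ℱ i) (f j)] with ω h1 h2
  rw [← h1]; exact h2

/-- Doob's `L_s` maximal inequality for Banach space valued martingales. -/
theorem eLpNorm_maxNorm_le [IsProbabilityMeasure P] {s : ℝ≥0∞} (hs : 1 < s) (hs' : s < ∞)
    (hf : Martingale f ℱ P) (hfs : ∀ k, MemLp (f k) s P) (n : ℕ) :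
    eLpNorm (maxNorm f n) s P
      ≤ ENNReal.ofReal (s.toReal / (s.toReal - 1)) * eLpNorm (f n) s P := by
  have hM : Measurable (maxNorm f n) :=
    (((maxNorm_stronglyAdapted hf.1) n).mono (ℱ.le n)).measurable
  have hfn : StronglyMeasurable (fun ω => ‖f n ω‖) := ((hf.1 n).mono (ℱ.le n)).norm
  rw [← eLpNorm_norm (f n)]
  refine eLpNorm_le_of_lintegral_le_mul hs hs' (maxNorm_nonneg f n) (fun _ => norm_nonneg _)
    (memLp_maxNorm hfs n) hfn.measurable.aemeasurable ?_
  refine lintegral_rpow_le_of_weak_type (one_lt_toReal hs hs') (maxNorm_nonneg f n) hM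
    hfn.measurable.ennreal_ofReal fun t ht => ?_
  have := maximal_ineq (submartingale_norm hf) (fun _ _ => norm_nonneg _) (ε := t.toNNReal) n
  simp only [maxNorm_eq_sup', Real.coe_toNNReal t ht.le] at this
  rw [← ofReal_integral_eq_lintegral_ofReal (hf.integrable n).norm.integrableOn
    (ae_of_all _ fun _ => norm_nonneg _)]
  exact this

end Doob

/-! ### Sign transforms and integration of good-`λ` inequalities -/

/-- The transform `∑_{k ≤ n} ε_k df_k` of a process by a sequence of scalars. -/
def signTransform {Ω X : Type*} [AddCommGroup X] [Module ℝ X] (ε : ℕ → ℝ) (f : ℕ → Ω → X) :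
    ℕ → Ω → X :=
  fun n ω => ∑ k ∈ Finset.range (n + 1), ε k • martingaleDiff f k ω

section SignTransform

variable {Ω X : Type*} [NormedAddCommGroup X] [NormedSpace ℝ X] {f : ℕ → Ω → X} {ε : ℕ → ℝ}

theorem signTransform_succ_sub (ε : ℕ → ℝ) (f : ℕ → Ω → X) (n : ℕ) (ω : Ω) :
    signTransform ε f (n + 1) ω - signTransform ε f n ω = ε (n + 1) • (f (n + 1) ω - f n ω) := by
  simp only [signTransform]
  rw [Finset.sum_range_succ _ (n + 1), add_sub_cancel_left]
  rfl

theorem signTransform_stronglyAdapted {m0 : MeasurableSpace Ω} {ℱ : Filtration ℕ m0}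
    (hf : StronglyAdapted ℱ f) : StronglyAdapted ℱ (signTransform ε f) := fun _ =>
  Finset.stronglyMeasurable_fun_sum _ fun k hk =>
    ((martingaleDiff_stronglyAdapted hf k).mono
      (ℱ.mono (Nat.lt_succ_iff.1 (Finset.mem_range.1 hk)))).const_smul (ε k)

theorem memLp_signTransform {m0 : MeasurableSpace Ω} {P : Measure Ω} {s : ℝ≥0∞}
    (hf : ∀ k, MemLp (f k) s P) (n : ℕ) : MemLp (signTransform ε f n) s P :=
  memLp_finsetSum _ fun k _ => (memLp_martingaleDiff hf k).const_smul (ε k)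

theorem norm_smul_of_sign {e : ℝ} (he : e = 1 ∨ e = -1) (x : X) : ‖e • x‖ = ‖x‖ := by
  rcases he with rfl | rfl <;> simp

end SignTransform

/-- A sum of increments over an order-connected set of times telescopes to the increment between
the first and the last time. -/
theorem sum_ite_sub_of_ordConnected {X : Type*} [AddCommGroup X] (x : ℕ → X) (V : ℕ → Prop)
    [DecidablePred V] (hV : ∀ i j k, i ≤ j → j ≤ k → V i → V k → V j) (n : ℕ) :
    ((∀ k < n, ¬ V k) ∧ ∑ k ∈ Finset.range n, (if V k then x (k + 1) - x k else 0) = 0) ∨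
    ∃ a b, a ≤ b ∧ b < n ∧ V a ∧ V b ∧ (∀ k < n, V k → a ≤ k ∧ k ≤ b) ∧
      ∑ k ∈ Finset.range n, (if V k then x (k + 1) - x k else 0) = x (b + 1) - x a := by
  induction n with
  | zero => left; simp
  | succ n ih =>
    rw [Finset.sum_range_succ]
    by_cases hn : V n
    · right
      rcases ih with ⟨h1, h2⟩ | ⟨a, b, hab, hbn, ha, hb, hm, hs⟩
      · refine ⟨n, n, le_rfl, n.lt_succ_self, hn, hn, fun k hk hVk => ?_, by simp [h2, hn]⟩
        have : k = n := by
          by_contra hne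
          exact h1 k (by omega) hVk
        omega
      · have hb1 : b + 1 = n := by
          by_contra hne
          have := (hm (b + 1) (by omega) (hV b (b + 1) n (by omega) (by omega) hb hn)).2
          omega
        refine ⟨a, n, by omega, n.lt_succ_self, ha, hn, fun k hk hVk => ?_, ?_⟩
        · rcases Nat.lt_succ_iff_lt_or_eq.1 hk with h | h
          · exact ⟨(hm k h hVk).1, by omega⟩
          · omega
        · rw [hs, if_pos hn, hb1]; abel
    · rw [if_neg hn, add_zero]
      rcases ih with ⟨h1, h2⟩ | ⟨a, b, hab, hbn, ha, hb, hm, hs⟩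
      · left
        refine ⟨fun k hk => ?_, h2⟩
        rcases Nat.lt_succ_iff_lt_or_eq.1 hk with h | h
        · exact h1 k h
        · exact h ▸ hn
      · right
        refine ⟨a, b, hab, by omega, ha, hb, fun k hk hVk => ?_, hs⟩
        rcases Nat.lt_succ_iff_lt_or_eq.1 hk with h | h
        · exact hm k h hVk
        · exact absurd (h ▸ hVk) hn

/-- Integration of a good-`λ` inequality. -/
theorem eLpNorm_le_of_good_lambda {Ω : Type*} {m0 : MeasurableSpace Ω} {P : Measure Ω}
    {s : ℝ≥0∞} (hs : 1 < s) (hs' : s < ∞) {u v : Ω → ℝ} (hu0 : ∀ ω, 0 ≤ u ω) (hv0 : ∀ ω, 0 ≤ v ω)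
    (hu : MemLp u s P) (hv : AEMeasurable v P) {δ : ℝ} (hδ : 0 < δ) {κ : ℝ≥0∞}
    (hκ : κ ≤ (2 * 3 ^ s.toReal)⁻¹)
    (h : ∀ t : ℝ, 0 < t → P {ω | 3 * t < u ω} ≤ P {ω | δ * t < v ω} + κ * P {ω | t < u ω}) :
    eLpNorm u s P ≤ ENNReal.ofReal (6 / δ) * eLpNorm v s P := by
  set σ := s.toReal with hσdef
  have hσ : 1 < σ := one_lt_toReal hs hs'
  have hσ0 : 0 < σ := by linarith
  set I := ∫⁻ ω, ENNReal.ofReal (u ω) ^ σ ∂P with hI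
  set J := ∫⁻ ω, ENNReal.ofReal (v ω) ^ σ ∂P with hJ
  have hIfin : I ≠ ∞ := lintegral_ofReal_rpow_ne_top hs hs' hu0 hu
  have hu3 : ∀ ω, 0 ≤ u ω / 3 := fun ω => div_nonneg (hu0 ω) (by norm_num)
  have hvδ : ∀ ω, 0 ≤ v ω / δ := fun ω => div_nonneg (hv0 ω) hδ.le
  have hum := hu.1.aemeasurable
  have h30 : (3 : ℝ≥0∞) ^ σ ≠ 0 := by simp
  have h3t : (3 : ℝ≥0∞) ^ σ ≠ ∞ := by simp
  have hκt : κ ≠ ∞ := by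
    refine (hκ.trans_lt (ENNReal.inv_lt_top.2 ?_)).ne
    exact pos_iff_ne_zero.2 (mul_ne_zero two_ne_zero h30)
  have L1 := lintegral_rpow_eq_lintegral_meas_lt_mul P (ae_of_all _ hu3) (hum.div_const 3) hσ0
  have L2 := lintegral_rpow_eq_lintegral_meas_lt_mul P (ae_of_all _ hvδ) (hv.div_const δ) hσ0
  have L3 := lintegral_rpow_eq_lintegral_meas_lt_mul P (ae_of_all _ hu0) hum hσ0
  have hscale : ∀ (w : Ω → ℝ) (c : ℝ), 0 < c → (∀ ω, 0 ≤ w ω) →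
      ∫⁻ ω, ENNReal.ofReal ((w ω / c) ^ σ) ∂P
        = ENNReal.ofReal (c⁻¹) ^ σ * ∫⁻ ω, ENNReal.ofReal (w ω) ^ σ ∂P := by
    intro w c hc hw
    rw [← lintegral_const_mul' _ _ (by simp [hσ0.le])]
    refine lintegral_congr fun ω => ?_
    rw [← ENNReal.mul_rpow_of_nonneg _ _ hσ0.le, ← ENNReal.ofReal_mul (by positivity),
      ENNReal.ofReal_rpow_of_nonneg (mul_nonneg (by positivity) (hw ω)) hσ0.le, div_eq_inv_mul]
  have key : ∫⁻ ω, ENNReal.ofReal ((u ω / 3) ^ σ) ∂P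
      ≤ ∫⁻ ω, ENNReal.ofReal ((v ω / δ) ^ σ) ∂P + κ * ∫⁻ ω, ENNReal.ofReal (u ω ^ σ) ∂P := by
    rw [L1, L2, L3, mul_left_comm, ← mul_add, ← lintegral_const_mul' κ _ hκt,
      ← lintegral_add_left']
    · refine mul_le_mul_right (setLIntegral_mono' measurableSet_Ioi fun t (ht : 0 < t) => ?_) _
      rw [← mul_assoc, ← add_mul]
      refine mul_le_mul_left ?_ _
      have e1 : {ω | t < u ω / 3} = {ω | 3 * t < u ω} := by
        ext ω; simp [lt_div_iff₀, mul_comm]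
      have e2 : {ω | t < v ω / δ} = {ω | δ * t < v ω} := by
        ext ω; simp [lt_div_iff₀ hδ, mul_comm]
      rw [e1, e2]
      exact h t ht
    · refine AEMeasurable.mul ?_ (by fun_prop)
      refine (Antitone.measurable fun a b hab => measure_mono fun ω hω => ?_).aemeasurable
      exact lt_of_le_of_lt hab hω
  rw [hscale u 3 (by norm_num) hu0, hscale v δ hδ hv0] at key
  simp only [← ENNReal.ofReal_rpow_of_nonneg (hu0 _) hσ0.le] at key
  rw [← hI, ← hJ] at key
  have h3 : (3 : ℝ≥0∞) ^ σ * ENNReal.ofReal (3⁻¹) ^ σ = 1 := by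
    rw [← ENNReal.mul_rpow_of_nonneg _ _ hσ0.le, ENNReal.ofReal_inv_of_pos (by norm_num)]
    simp [ENNReal.mul_inv_cancel]
  -- As `I` is finite, the term `I / 2` can be absorbed.
  have h4 : I ≤ 3 ^ σ * ENNReal.ofReal (δ⁻¹) ^ σ * J + I / 2 := by
    calc I = 3 ^ σ * (ENNReal.ofReal (3⁻¹) ^ σ * I) := by rw [← mul_assoc, h3, one_mul]
      _ ≤ 3 ^ σ * (ENNReal.ofReal (δ⁻¹) ^ σ * J + κ * I) := by gcongr
      _ ≤ 3 ^ σ * (ENNReal.ofReal (δ⁻¹) ^ σ * J + (2 * 3 ^ σ)⁻¹ * I) := by gcongr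
      _ = _ := by
        rw [mul_add, ← mul_assoc, ← mul_assoc, ENNReal.mul_inv (by simp) (by simp),
          mul_comm (2⁻¹ : ℝ≥0∞), ← mul_assoc, ENNReal.mul_inv_cancel h30 h3t, one_mul,
          ENNReal.div_eq_inv_mul]
  have h5 : I ≤ 2 * (3 ^ σ * ENNReal.ofReal (δ⁻¹) ^ σ * J) := by
    have hI2 : I / 2 ≠ ∞ := ENNReal.div_ne_top hIfin (by simp)
    have : I / 2 ≤ 3 ^ σ * ENNReal.ofReal (δ⁻¹) ^ σ * J := by
      have h6 : I / 2 + I / 2 ≤ 3 ^ σ * ENNReal.ofReal (δ⁻¹) ^ σ * J + I / 2 := by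
        rwa [ENNReal.add_halves]
      exact (ENNReal.add_le_add_iff_right hI2).1 h6
    calc I = 2 * (I / 2) := by rw [ENNReal.mul_div_cancel (by simp) (by simp)]
      _ ≤ _ := by gcongr
  have h2 : (2 : ℝ≥0∞) ≤ 2 ^ σ := by
    conv_lhs => rw [← ENNReal.rpow_one 2]
    exact ENNReal.rpow_le_rpow_of_exponent_le (by norm_num) hσ.le
  rw [eLpNorm_eq_lintegral_ofReal hs hs' hu0, eLpNorm_eq_lintegral_ofReal hs hs' hv0, ← hσdef,
    ← hI, ← hJ]
  calc I ^ (1 / σ) ≤ ((2 ^ σ) * (3 ^ σ * ENNReal.ofReal (δ⁻¹) ^ σ * J)) ^ (1 / σ) := by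
        refine ENNReal.rpow_le_rpow (h5.trans ?_) (by positivity)
        gcongr
    _ = ENNReal.ofReal (6 / δ) * J ^ (1 / σ) := by
        rw [← mul_assoc, ← mul_assoc, ← ENNReal.mul_rpow_of_nonneg _ _ hσ0.le,
          ← ENNReal.mul_rpow_of_nonneg _ _ hσ0.le, ENNReal.mul_rpow_of_nonneg _ _ (by positivity),
          ← ENNReal.rpow_mul, mul_one_div_cancel hσ0.ne', ENNReal.rpow_one, div_eq_mul_inv 6 δ,
          ENNReal.ofReal_mul (by norm_num)]
        congr 2
        norm_num

/-! ### The good-`λ` inequality for martingales with predictably dominated increments -/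

section GoodLambda

variable {X : Type*} [NormedAddCommGroup X]

/-- The deterministic half of the good-`λ` inequality: if all increments of `g` up to time `n` are
at most `d` and `|g 0| ≤ t`, and the running maximum of `|g|` exceeds `3 t` by time `n`, then the
increment of `g` between the first passage above `t` and the first passage above `3 t` has norm at
least `t`. -/
theorem le_norm_sum_ite_of_lt_maxNorm {Ω : Type*} (g : ℕ → Ω → X) (ω : Ω) {t d : ℝ} {n : ℕ}
    (hd : d ≤ t) (h0 : ‖g 0 ω‖ ≤ t) (hjump : ∀ k < n, ‖g (k + 1) ω - g k ω‖ ≤ d)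
    (V : ℕ → Prop) [DecidablePred V] (hV : ∀ i j k, i ≤ j → j ≤ k → V i → V k → V j)
    (hVn : ∀ k < n, V k ↔ t < maxNorm g k ω ∧ maxNorm g k ω ≤ 3 * t)
    (hn : 3 * t < maxNorm g n ω) :
    t ≤ ‖∑ k ∈ Finset.range n, (if V k then g (k + 1) ω - g k ω else 0)‖ := by
  have ht : 0 ≤ t := (norm_nonneg _).trans h0
  have hstep : ∀ k < n, maxNorm g (k + 1) ω ≤ maxNorm g k ω + d := by
    intro k hk
    have h1 := hjump k hk
    have h2 := norm_le_maxNorm g (le_refl k) ω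
    have h3 : ‖g (k + 1) ω‖ ≤ ‖g k ω‖ + ‖g (k + 1) ω - g k ω‖ := by
      have := norm_add_le (g k ω) (g (k + 1) ω - g k ω)
      rwa [add_sub_cancel] at this
    have h4 : 0 ≤ d := (norm_nonneg _).trans h1
    exact max_le (by linarith) (by linarith)
  rcases sum_ite_sub_of_ordConnected (fun k => g k ω) V hV n with
    ⟨hno, -⟩ | ⟨a, b, hab, hbn, ha, hb, hm, hs⟩
  · exfalso
    have hsmall : ∀ k ≤ n, maxNorm g k ω ≤ 2 * t := by
      intro k
      induction k with
      | zero => intro _; simp only [maxNorm]; linarith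
      | succ k ih =>
        intro hk
        have h1 := ih (by omega)
        have h2 := mt (hVn k (by omega)).2 (hno k (by omega))
        have h3 : maxNorm g k ω ≤ t := by
          by_contra hcon
          exact h2 ⟨not_le.1 hcon, by linarith⟩
        have := hstep k (by omega)
        linarith
    have := hsmall n le_rfl
    linarith
  · rw [hs]
    have hga : ‖g a ω‖ ≤ 2 * t := by
      have hVa := (hVn a (by omega)).1 ha
      cases a with
      | zero => linarith
      | succ a =>
        have h1 : ¬ V a := fun h => by have := (hm a (by omega) h).1; omega
        have h2 := mt (hVn a (by omega)).2 h1
        have h3 : maxNorm g a ω ≤ t := by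
          by_contra hcon
          exact h2 ⟨not_le.1 hcon, (maxNorm_mono g ω a.le_succ).trans hVa.2⟩
        have h4 := hstep a (by omega)
        have h5 := norm_le_maxNorm g (le_refl (a + 1)) ω
        linarith
    have hgb : 3 * t < ‖g (b + 1) ω‖ := by
      have hVb := (hVn b hbn).1 hb
      have h1 : 3 * t < maxNorm g (b + 1) ω := by
        rcases eq_or_lt_of_le (Nat.succ_le_of_lt hbn) with h | h
        · rw [← h] at hn; exact hn
        · have h2 : ¬ V (b + 1) := fun h' => by have := (hm (b + 1) h h').2; omega
          by_contra hcon
          exact h2 ((hVn (b + 1) h).2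
            ⟨hVb.1.trans_le (maxNorm_mono g ω b.le_succ), not_lt.1 hcon⟩)
      by_contra hcon
      exact absurd h1 (not_lt.2 (max_le hVb.2 (not_lt.1 hcon)))
    have := norm_sub_norm_le (g (b + 1) ω) (g a ω)
    show t ≤ ‖g (b + 1) ω - g a ω‖
    linarith

variable [NormedSpace ℝ X] [CompleteSpace X] {Ω : Type} {m0 : MeasurableSpace Ω} {P : Measure Ω}
  [IsProbabilityMeasure P] {ℱ : Filtration ℕ m0} {f : ℕ → Ω → X} {w : ℕ → Ω → ℝ}

/-- Sums of martingale increments over predictable sets form a martingale. -/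
theorem martingale_sum_indicator (hf : Martingale f ℱ P) {A : ℕ → Set Ω}
    (hA : ∀ k, MeasurableSet[ℱ k] (A k)) :
    Martingale (fun n ω => ∑ k ∈ Finset.range n, (A k).indicator (f (k + 1) - f k) ω) ℱ P := by
  have hint : ∀ k, Integrable ((A k).indicator (f (k + 1) - f k)) P := fun k =>
    ((hf.integrable (k + 1)).sub (hf.integrable k)).indicator (ℱ.le k _ (hA k))
  refine martingale_of_condExp_sub_eq_zero_nat (fun n => ?_) (fun n => ?_) fun n => ?_
  · refine Finset.stronglyMeasurable_fun_sum _ fun k hk => ?_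
    have hkn : k + 1 ≤ n := Finset.mem_range.1 hk
    have h1 : StronglyMeasurable[ℱ n] (f (k + 1) - f k) :=
      ((hf.1 (k + 1)).mono (ℱ.mono hkn)).sub ((hf.1 k).mono (ℱ.mono (by omega)))
    exact h1.indicator (ℱ.mono (by omega) _ (hA k))
  · exact integrable_finsetSum _ fun k _ => hint k
  · have e : ((fun ω => ∑ k ∈ Finset.range (n + 1), (A k).indicator (f (k + 1) - f k) ω)
        - fun ω => ∑ k ∈ Finset.range n, (A k).indicator (f (k + 1) - f k) ω)
        = (A n).indicator (f (n + 1) - f n) := by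
      ext ω
      simp [Finset.sum_range_succ]
    rw [e]
    refine (condExp_indicator ((hf.integrable (n + 1)).sub (hf.integrable n)) (hA n)).trans ?_
    have h1 := condExp_sub (hf.integrable (n + 1)) (hf.integrable n) (ℱ n)
    filter_upwards [h1, hf.2 n (n + 1) n.le_succ, hf.2 n n le_rfl] with ω h1 h2 h3
    by_cases hω : ω ∈ A n
    · simp [hω, h1, h2, h3]
    · simp [hω]

/-- Burkholder's good-`λ` inequality for the sign transform of a martingale whose increments are
dominated by a predictable increasing process. The `UMD_r` inequality is applied to the part of the
martingale between the first passages of the transform above `t` and above `3 t`. -/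
theorem measure_lt_maxNorm_signTransform_le {r : ℝ≥0∞} (hr : 1 < r) (hr' : r < ∞) {C : ℝ≥0∞}
    (hC : IsUMDBound r X C) (hf : Martingale f ℱ P) (hw : StronglyAdapted ℱ w)
    (hwm : ∀ ω, Monotone fun k => w k ω) (hd : ∀ k, ∀ᵐ ω ∂P, ‖f (k + 1) ω - f k ω‖ ≤ w k ω)
    {ε : ℕ → ℝ} (hε : ∀ k, ε k = 1 ∨ ε k = -1) (n : ℕ) {δ t : ℝ} (hδ : 0 < δ) (hδ1 : δ ≤ 1)
    (ht : 0 < t) :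
    P {ω | 3 * t < maxNorm (signTransform ε f) n ω}
      ≤ P {ω | δ * t < max (maxNorm f n ω) (w n ω)}
        + (C * ENNReal.ofReal (3 * δ)) ^ r.toReal
          * P {ω | t < maxNorm (signTransform ε f) n ω} := by
  classical
  have hρ : 1 < r.toReal := one_lt_toReal hr hr'
  have hr0 : r ≠ 0 := by positivity
  set g := signTransform ε f with hg
  have hgad : StronglyAdapted ℱ g := signTransform_stronglyAdapted hf.1
  have hgm : ∀ k, Measurable[ℱ k] (maxNorm g k) := fun k =>
    (maxNorm_stronglyAdapted hgad k).measurable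
  have hfm : ∀ k, Measurable[ℱ k] (maxNorm f k) := fun k =>
    (maxNorm_stronglyAdapted hf.1 k).measurable
  -- `V ω k`: time `k` lies between the passages of `g` above `t` and `3 t`, and neither `f` nor `w`
  -- has exceeded `δ t`. This is known at time `k`, and governs the increment from `k` to `k + 1`.
  set V : Ω → ℕ → Prop := fun ω k => (t < maxNorm g k ω ∧ maxNorm g k ω ≤ 3 * t) ∧
    maxNorm f k ω ≤ δ * t ∧ w k ω ≤ δ * t with hVdef
  have hVconn : ∀ ω i j k, i ≤ j → j ≤ k → V ω i → V ω k → V ω j := by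
    intro ω i j k hij hjk hi hk
    exact ⟨⟨hi.1.1.trans_le (maxNorm_mono g ω hij), (maxNorm_mono g ω hjk).trans hk.1.2⟩,
      (maxNorm_mono f ω hjk).trans hk.2.1, (hwm ω hjk).trans hk.2.2⟩
  set A : ℕ → Set Ω := fun k => {ω | V ω k} with hA
  have hAm : ∀ k, MeasurableSet[ℱ k] (A k) := by
    intro k
    have m1 : MeasurableSet[ℱ k] {ω | t < maxNorm g k ω} :=
      measurableSet_lt (mδ := ℱ k) measurable_const (hgm k)
    have m2 : MeasurableSet[ℱ k] {ω | maxNorm g k ω ≤ 3 * t} :=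
      measurableSet_le (mδ := ℱ k) (hgm k) measurable_const
    have m3 : MeasurableSet[ℱ k] {ω | maxNorm f k ω ≤ δ * t} :=
      measurableSet_le (mδ := ℱ k) (hfm k) measurable_const
    have m4 : MeasurableSet[ℱ k] {ω | w k ω ≤ δ * t} :=
      measurableSet_le (mδ := ℱ k) (hw k).measurable measurable_const
    exact (m1.inter m2).inter (m3.inter m4)
  set h : ℕ → Ω → X := fun n ω => ∑ k ∈ Finset.range n, (A k).indicator (f (k + 1) - f k) ω with hh
  have hmart : Martingale h ℱ P := martingale_sum_indicator hf hAm
  have hsum : ∀ (x : ℕ → Ω → X) m ω, ∑ k ∈ Finset.range m, (A k).indicator (x (k + 1) - x k) ω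
      = ∑ k ∈ Finset.range m, (if V ω k then x (k + 1) ω - x k ω else 0) := by
    intro x m ω
    refine Finset.sum_congr rfl fun k _ => ?_
    simp [Set.indicator_apply, hA]
  have hbound : ∀ᵐ ω ∂P, ∀ m, ‖h m ω‖ ≤ 3 * δ * t ∧ (h m ω ≠ 0 → t < maxNorm g m ω) := by
    filter_upwards [ae_all_iff.2 hd] with ω hω m
    rcases sum_ite_sub_of_ordConnected (fun k => f k ω) (V ω) (hVconn ω) m with
      ⟨-, h0⟩ | ⟨a, b, hab, hbn, ha, hb, -, hs⟩
    · have : h m ω = 0 := (hsum f m ω).trans h0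
      rw [this]
      simpa using by positivity
    · have e : h m ω = f (b + 1) ω - f a ω := (hsum f m ω).trans hs
      rw [e]
      refine ⟨?_, fun _ => hb.1.1.trans_le (maxNorm_mono g ω hbn.le)⟩
      have h1 := hω b
      have h2 := norm_le_maxNorm f (le_refl b) ω
      have h3 := norm_le_maxNorm f hab ω
      have h4 : ‖f (b + 1) ω - f a ω‖ ≤ ‖f (b + 1) ω - f b ω‖ + (‖f b ω‖ + ‖f a ω‖) := by
        have := norm_add_le (f (b + 1) ω - f b ω) (f b ω - f a ω)
        rw [sub_add_sub_cancel] at this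
        exact this.trans (add_le_add_right (norm_sub_le _ _) _)
      have h5 := hb.2.1
      have h6 := hb.2.2
      linarith
  have hmem : ∀ k, MemLp (h k) r P := fun k =>
    MemLp.of_bound (hmart.integrable k).1 (3 * δ * t) (hbound.mono fun ω hω => (hω k).1)
  have hU := hC Ω m0 P inferInstance ℱ h hmart hmem n ε hε
  simp only [sum_range_martingaleDiff] at hU
  set S : Set Ω := {ω | t < maxNorm g n ω} with hS
  have hSm : MeasurableSet S :=
    measurableSet_lt measurable_const ((hgm n).mono (ℱ.le n) le_rfl)
  set F : Ω → ℝ := fun ω => max (maxNorm f n ω) (w n ω) with hF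
  have hFm : Measurable F :=
    ((hfm n).mono (ℱ.le n) le_rfl).max ((hw n).measurable.mono (ℱ.le n) le_rfl)
  set B : Set Ω := {ω | 3 * t < maxNorm g n ω ∧ F ω ≤ δ * t} with hB
  have hBm : MeasurableSet B :=
    (measurableSet_lt measurable_const ((hgm n).mono (ℱ.le n) le_rfl)).inter
      (measurableSet_le hFm measurable_const)
  have hup : eLpNorm (h n) r P ≤ ENNReal.ofReal (3 * δ * t) * P S ^ (1 / r.toReal) := by
    have h1 : eLpNorm (h n) r P ≤ eLpNorm (S.indicator fun _ => (3 * δ * t : ℝ)) r P := by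
      refine eLpNorm_mono_ae ?_
      filter_upwards [hbound] with ω hω
      by_cases hωS : ω ∈ S
      · rw [Set.indicator_of_mem hωS]
        exact (hω n).1.trans (le_abs_self _)
      · have : h n ω = 0 := by
          by_contra hcon
          exact hωS ((hω n).2 hcon)
        rw [this]; simp
    refine h1.trans_eq ?_
    rw [eLpNorm_indicator_const hSm hr0 hr'.ne, Real.enorm_of_nonneg (by positivity)]
  have hlow : ENNReal.ofReal t * P B ^ (1 / r.toReal)
      ≤ eLpNorm (fun ω => ∑ k ∈ Finset.range (n + 1), ε k • martingaleDiff h k ω) r P := by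
    have h1 : eLpNorm (B.indicator fun _ => (t : ℝ)) r P
        = ENNReal.ofReal t * P B ^ (1 / r.toReal) := by
      rw [eLpNorm_indicator_const hBm hr0 hr'.ne, Real.enorm_of_nonneg ht.le]
    rw [← h1]
    refine eLpNorm_mono_ae ?_
    filter_upwards [ae_all_iff.2 hd] with ω hω
    by_cases hωB : ω ∈ B
    · rw [Set.indicator_of_mem hωB, Real.norm_of_nonneg ht.le]
      have hFω : maxNorm f n ω ≤ δ * t ∧ w n ω ≤ δ * t := max_le_iff.1 hωB.2
      have hδt : δ * t ≤ t := by nlinarith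
      have e : ∑ k ∈ Finset.range (n + 1), ε k • martingaleDiff h k ω
          = ∑ k ∈ Finset.range n, (if V ω k then g (k + 1) ω - g k ω else 0) := by
        rw [Finset.sum_range_succ']
        have h0 : ε 0 • martingaleDiff h 0 ω = 0 := by simp [martingaleDiff, hh]
        rw [h0, add_zero]
        refine Finset.sum_congr rfl fun k _ => ?_
        have h3 : g (k + 1) ω - g k ω = ε (k + 1) • (f (k + 1) ω - f k ω) :=
          signTransform_succ_sub ε f k ω
        have h2 : martingaleDiff h (k + 1) ω = (if V ω k then f (k + 1) ω - f k ω else 0) := by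
          simp [martingaleDiff, hh, Finset.sum_range_succ, Set.indicator_apply, hA]
        rw [h2, h3]
        split_ifs <;> simp
      rw [e]
      refine le_norm_sum_ite_of_lt_maxNorm g ω (d := δ * t) hδt ?_ (fun k hk => ?_) (V ω)
        (hVconn ω) (fun k hk => ?_) hωB.1
      · have h1 : ‖g 0 ω‖ = ‖f 0 ω‖ := by
          simp only [hg, signTransform]
          simp [martingaleDiff, norm_smul_of_sign (hε 0)]
        rw [h1]
        exact ((norm_le_maxNorm f (Nat.zero_le n) ω).trans hFω.1).trans hδt
      · rw [hg, signTransform_succ_sub, norm_smul_of_sign (hε _)]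
        exact (hω k).trans ((hwm ω hk.le).trans hFω.2)
      · exact ⟨fun hv => hv.1, fun hv => ⟨hv, (maxNorm_mono f ω hk.le).trans hFω.1,
          (hwm ω hk.le).trans hFω.2⟩⟩
    · rw [Set.indicator_of_notMem hωB]; simp
  have hPB : P B ≤ (C * ENNReal.ofReal (3 * δ)) ^ r.toReal * P S := by
    have h1 := hlow.trans (hU.trans (mul_le_mul_right hup C))
    have h2 : ENNReal.ofReal t * P B ^ (1 / r.toReal)
        ≤ ENNReal.ofReal t * (C * ENNReal.ofReal (3 * δ) * P S ^ (1 / r.toReal)) := by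
      refine h1.trans_eq ?_
      rw [ENNReal.ofReal_mul (p := 3 * δ) (by positivity)]
      ring
    have h3 := (ENNReal.mul_le_mul_iff_right (by simpa using ht) ENNReal.ofReal_ne_top).1 h2
    have h4 := ENNReal.rpow_le_rpow h3 (show (0 : ℝ) ≤ r.toReal by positivity)
    rwa [ENNReal.mul_rpow_of_nonneg _ _ (by positivity), ← ENNReal.rpow_mul, ← ENNReal.rpow_mul,
      one_div_mul_cancel (by positivity), ENNReal.rpow_one, ENNReal.rpow_one] at h4
  calc P {ω | 3 * t < maxNorm g n ω} ≤ P ({ω | δ * t < F ω} ∪ B) := by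
        refine measure_mono fun ω hω => ?_
        rcases lt_or_ge (δ * t) (F ω) with h | h
        · exact Or.inl h
        · exact Or.inr ⟨hω, h⟩
    _ ≤ P {ω | δ * t < F ω} + P B := measure_union_le _ _
    _ ≤ _ := add_le_add_right hPB _

/-- Martingales with predictably dominated increments: the integrated good-`λ` inequality. The
constant is linear in the `UMD_r` bound `C`. -/
theorem eLpNorm_maxNorm_signTransform_le {r s : ℝ≥0∞} (hr : 1 < r) (hr' : r < ∞) (hs : 1 < s)
    (hs' : s < ∞) {C : ℝ≥0} (hC1 : 1 ≤ C) (hC : IsUMDBound r X C) (hf : Martingale f ℱ P)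
    (hfs : ∀ k, MemLp (f k) s P) (hw : StronglyAdapted ℱ w)
    (hwm : ∀ ω, Monotone fun k => w k ω) (hd : ∀ k, ∀ᵐ ω ∂P, ‖f (k + 1) ω - f k ω‖ ≤ w k ω)
    {ε : ℕ → ℝ} (hε : ∀ k, ε k = 1 ∨ ε k = -1) (n : ℕ) :
    eLpNorm (maxNorm (signTransform ε f) n) s P
      ≤ ENNReal.ofReal (36 * 3 ^ s.toReal) * C
        * eLpNorm (fun ω => max (maxNorm f n ω) (w n ω)) s P := by
  set K : ℝ := 3 ^ s.toReal with hK
  have hρ : 1 < r.toReal := one_lt_toReal hr hr'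
  have hK1 : 1 ≤ K := Real.one_le_rpow (by norm_num) (by positivity)
  have hC1' : (1 : ℝ) ≤ C := by exact_mod_cast hC1
  -- With this `δ` the factor `(3 C δ) ^ r` is at most `1 / (2 * 3 ^ s)`, whatever `r > 1` is.
  set δ : ℝ := (6 * K * C)⁻¹ with hδ
  have hδ0 : 0 < δ := by positivity
  have hδ1 : δ ≤ 1 := inv_le_one_of_one_le₀ (by nlinarith)
  have hFm : Measurable fun ω => max (maxNorm f n ω) (w n ω) :=
    ((maxNorm_stronglyAdapted hf.1 n).mono (ℱ.le n)).measurable.max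
      ((hw n).mono (ℱ.le n)).measurable
  have e : (C : ℝ≥0∞) * ENNReal.ofReal (3 * δ) = (2 * 3 ^ s.toReal)⁻¹ := by
    have h1 : (C : ℝ≥0∞) = ENNReal.ofReal C := by simp
    have h2 : (2 * 3 ^ s.toReal : ℝ≥0∞) = ENNReal.ofReal (2 * K) := by
      rw [ENNReal.ofReal_mul (by norm_num), hK,
        ← ENNReal.ofReal_rpow_of_nonneg (by norm_num) (by positivity)]
      norm_num
    rw [h1, h2, ← ENNReal.ofReal_mul (by positivity), ← ENNReal.ofReal_inv_of_pos (by positivity)]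
    congr 1
    rw [hδ]
    field_simp
    norm_num
  have hfin := eLpNorm_le_of_good_lambda hs hs' (P := P) (maxNorm_nonneg (signTransform ε f) n)
    (fun ω => (maxNorm_nonneg f n ω).trans (le_max_left _ (w n ω)))
    (memLp_maxNorm (memLp_signTransform hfs) n) hFm.aemeasurable hδ0
    (κ := (C * ENNReal.ofReal (3 * δ)) ^ r.toReal) ?_
    (fun t ht => measure_lt_maxNorm_signTransform_le hr hr' hC hf hw hwm hd hε n hδ0 hδ1 ht)
  · refine hfin.trans_eq ?_
    congr 1
    have h1 : (C : ℝ≥0∞) = ENNReal.ofReal C := by simp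
    rw [h1, ← ENNReal.ofReal_mul (by positivity), hδ]
    congr 1
    field_simp
    norm_num
  · rw [e]
    calc ((2 * 3 ^ s.toReal : ℝ≥0∞)⁻¹) ^ r.toReal ≤ ((2 * 3 ^ s.toReal : ℝ≥0∞)⁻¹) ^ (1 : ℝ) := by
          refine ENNReal.rpow_le_rpow_of_exponent_ge ?_ hρ.le
          rw [ENNReal.inv_le_one]
          have : (1 : ℝ≥0∞) ≤ 3 ^ s.toReal :=
            ENNReal.one_le_rpow (by norm_num) (by linarith [one_lt_toReal hs hs'])
          calc (1 : ℝ≥0∞) = 1 * 1 := by ring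
            _ ≤ 2 * 3 ^ s.toReal := by gcongr; norm_num
      _ = _ := ENNReal.rpow_one _

end GoodLambda

/-! ### Davis' decomposition and extrapolation of the exponent -/

section Compensator

/-- The pull-out property of the conditional expectation for nonnegative functions; no integrability
of the multiplier `φ` is needed. -/
theorem lintegral_condExp_mul {Ω : Type*} {m m0 : MeasurableSpace Ω} {P : Measure Ω}
    [IsProbabilityMeasure P] (hm : m ≤ m0) {z : Ω → ℝ}
    (hz : Integrable z P) (hz0 : 0 ≤ᵐ[P] z) {φ : Ω → ℝ≥0∞} (hφ : Measurable[m] φ) :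
    ∫⁻ ω, ENNReal.ofReal ((P[z | m]) ω) * φ ω ∂P = ∫⁻ ω, ENNReal.ofReal (z ω) * φ ω ∂P := by
  have hφ' : Measurable φ := hφ.mono hm le_rfl
  have key : (P.withDensity fun ω => ENNReal.ofReal ((P[z | m]) ω)).trim hm
      = (P.withDensity fun ω => ENNReal.ofReal (z ω)).trim hm := by
    refine @Measure.ext _ m _ _ fun A hA => ?_
    rw [trim_measurableSet_eq hm hA, trim_measurableSet_eq hm hA, withDensity_apply _ (hm A hA),
      withDensity_apply _ (hm A hA),
      ← ofReal_integral_eq_lintegral_ofReal integrable_condExp.integrableOn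
        (ae_restrict_of_ae (condExp_nonneg hz0)),
      ← ofReal_integral_eq_lintegral_ofReal hz.integrableOn (ae_restrict_of_ae hz0),
      setIntegral_condExp hm hz hA]
  have h1 := lintegral_withDensity_eq_lintegral_mul₀ (μ := P)
    (f := fun ω => ENNReal.ofReal ((P[z | m]) ω))
    integrable_condExp.1.aemeasurable.ennreal_ofReal hφ'.aemeasurable
  have h2 := lintegral_withDensity_eq_lintegral_mul₀ (μ := P) (f := fun ω => ENNReal.ofReal (z ω))
    hz.1.aemeasurable.ennreal_ofReal hφ'.aemeasurable
  simp only [Pi.mul_apply] at h1 h2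
  rw [← h1, ← h2, ← lintegral_trim hm hφ, ← lintegral_trim hm hφ, key]

/-- Convexity of `x ↦ x ^ σ`, in the form of Bernoulli's inequality. -/
theorem rpow_le_rpow_add_mul_sub {σ x y : ℝ} (hσ : 1 ≤ σ) (hy : 0 ≤ y) (hyx : y ≤ x) :
    x ^ σ ≤ y ^ σ + σ * ((x - y) * x ^ (σ - 1)) := by
  rcases (hy.trans hyx).eq_or_lt with hx | hx
  · have : y = 0 := le_antisymm (hx ▸ hyx) hy
    subst this; subst hx; simp
  · have h1 := one_add_mul_self_le_rpow_one_add (s := (y - x) / x) (p := σ)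
      (by rw [le_div_iff₀ hx]; linarith) hσ
    have h2 : 1 + (y - x) / x = y / x := by field_simp; ring
    rw [h2, Real.div_rpow hy hx.le, le_div_iff₀ (by positivity)] at h1
    have h3 : x ^ σ = x * x ^ (σ - 1) := by
      conv_lhs => rw [show σ = 1 + (σ - 1) by ring, Real.rpow_add hx, Real.rpow_one]
    have h4 : (1 + σ * ((y - x) / x)) * x ^ σ = x ^ σ - σ * ((x - y) * x ^ (σ - 1)) := by
      rw [h3]; field_simp; ring
    linarith

variable {Ω : Type*} {m0 : MeasurableSpace Ω} {P : Measure Ω} [IsProbabilityMeasure P]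

/-- The compensator of an increasing adapted process in `L_s` is controlled in `L_s` by the process
itself. This is the inequality dual to Doob's. -/
theorem eLpNorm_compensator_le {s : ℝ≥0∞} (hs : 1 < s) (hs' : s < ∞) {ℱ : Filtration ℕ m0}
    {D : ℕ → Ω → ℝ} (hD0 : ∀ k ω, 0 ≤ D k ω)
    (hDm : ∀ ω, Monotone fun k => D k ω) (hDs : ∀ k, MemLp (D k) s P) (n : ℕ) :
    eLpNorm (fun ω => ∑ k ∈ Finset.range n, (P[D (k + 1) - D k | ℱ k]) ω) s P
      ≤ ENNReal.ofReal s.toReal * eLpNorm (D n) s P := by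
  set σ := s.toReal with hσdef
  have hσ : 1 < σ := one_lt_toReal hs hs'
  have hσ1 : 0 < σ - 1 := by linarith
  have hz : ∀ k, Integrable (D (k + 1) - D k) P := fun k =>
    ((hDs (k + 1)).sub (hDs k)).integrable hs.le
  have hz0 : ∀ k, 0 ≤ᵐ[P] D (k + 1) - D k := fun k =>
    ae_of_all _ fun ω => sub_nonneg.2 (hDm ω k.le_succ)
  -- Conditional expectations are nonnegative only almost everywhere; `e k` is a version that is
  -- nonnegative everywhere.
  set e : ℕ → Ω → ℝ := fun k ω => max ((P[D (k + 1) - D k | ℱ k]) ω) 0 with he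
  have he0 : ∀ k ω, 0 ≤ e k ω := fun k ω => le_max_right _ _
  have hee : ∀ k, e k =ᵐ[P] P[D (k + 1) - D k | ℱ k] := fun k => by
    filter_upwards [condExp_nonneg (m := ℱ k) (hz0 k)] with ω hω
    exact max_eq_left hω
  set A : ℕ → Ω → ℝ := fun n ω => ∑ k ∈ Finset.range n, e k ω with hA
  have hAs : ∀ n ω, A (n + 1) ω = A n ω + e n ω := fun n ω => Finset.sum_range_succ _ _
  have hAm : ∀ ω, Monotone fun k => A k ω := fun ω => monotone_nat_of_le_succ fun k => by
    rw [hAs]; linarith [he0 k ω]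
  have hA0 : ∀ n ω, 0 ≤ A n ω := fun n ω => Finset.sum_nonneg fun k _ => he0 k ω
  have hes : ∀ k, StronglyMeasurable[ℱ k] (e k) := fun k =>
    @StronglyMeasurable.sup Ω ℝ _ _ (ℱ k) _ _ _ stronglyMeasurable_condExp
      (@stronglyMeasurable_const Ω ℝ (ℱ k) _ 0)
  have hApred : ∀ k, StronglyMeasurable[ℱ k] (A (k + 1)) := fun k =>
    Finset.stronglyMeasurable_fun_sum _ fun j hj =>
      (hes j).mono (ℱ.mono (Nat.lt_succ_iff.1 (Finset.mem_range.1 hj)))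
  have hAmem : MemLp (A n) s P := memLp_finsetSum _ fun k _ =>
    (memLp_congr_ae (hee k)).2 (((hDs (k + 1)).sub (hDs k)).condExp hs.le)
  have hcongr : (fun ω => ∑ k ∈ Finset.range n, (P[D (k + 1) - D k | ℱ k]) ω) =ᵐ[P] A n := by
    filter_upwards [ae_all_iff.2 hee] with ω hω
    exact Finset.sum_congr rfl fun k _ => (hω k).symm
  rw [eLpNorm_congr_ae hcongr]
  refine eLpNorm_le_of_lintegral_le_mul hs hs' (hA0 n) (hD0 n) hAmem
    (hDs n).1.aemeasurable ?_
  -- Summation of the convexity inequality; the factor `A (k + 1)` is `ℱ k`-measurable, so that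
  -- `e k` may be replaced by `D (k + 1) - D k` under the integral.
  have hpt : ∀ n ω, A n ω ^ σ ≤ ∑ k ∈ Finset.range n, σ * (e k ω * A (k + 1) ω ^ (σ - 1)) := by
    intro n ω
    induction n with
    | zero => simp [hA, Real.zero_rpow (by linarith : σ ≠ 0)]
    | succ n ih =>
      rw [Finset.sum_range_succ]
      have h1 := rpow_le_rpow_add_mul_sub hσ.le (hA0 n ω) (hAm ω n.le_succ)
      have h2 : A (n + 1) ω - A n ω = e n ω := by rw [hAs]; ring
      simp only [Nat.succ_eq_add_one, h2] at h1
      linarith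
  have hAmeas : ∀ k, Measurable[ℱ k] fun ω => ENNReal.ofReal (A (k + 1) ω) ^ (σ - 1) := fun k =>
    ((hApred k).measurable.ennreal_ofReal).pow_const _
  have hnn : ∀ k ω, (0 : ℝ) ≤ e k ω * A (k + 1) ω ^ (σ - 1) := fun k ω =>
    mul_nonneg (he0 k ω) (Real.rpow_nonneg (hA0 _ ω) _)
  calc ∫⁻ ω, ENNReal.ofReal (A n ω) ^ σ ∂P
      ≤ ∫⁻ ω, ENNReal.ofReal σ * ∑ k ∈ Finset.range n,
          ENNReal.ofReal (e k ω) * ENNReal.ofReal (A (k + 1) ω) ^ (σ - 1) ∂P := by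
        refine lintegral_mono fun ω => ?_
        rw [ENNReal.ofReal_rpow_of_nonneg (hA0 n ω) (by linarith)]
        refine (ENNReal.ofReal_le_ofReal (hpt n ω)).trans_eq ?_
        rw [← Finset.mul_sum, ENNReal.ofReal_mul (by linarith),
          ENNReal.ofReal_sum_of_nonneg fun k _ => hnn k ω]
        congr 1
        refine Finset.sum_congr rfl fun k _ => ?_
        rw [ENNReal.ofReal_mul (he0 k ω), ENNReal.ofReal_rpow_of_nonneg (hA0 _ ω) hσ1.le]
    _ = ENNReal.ofReal σ * ∑ k ∈ Finset.range n,
          ∫⁻ ω, ENNReal.ofReal (e k ω) * ENNReal.ofReal (A (k + 1) ω) ^ (σ - 1) ∂P := by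
        rw [lintegral_const_mul' _ _ ENNReal.ofReal_ne_top, lintegral_finsetSum]
        intro k _
        exact (((hes k).mono (ℱ.le k)).measurable.ennreal_ofReal).mul
          ((hAmeas k).mono (ℱ.le k) le_rfl)
    _ = ENNReal.ofReal σ * ∑ k ∈ Finset.range n,
          ∫⁻ ω, ENNReal.ofReal ((D (k + 1) - D k) ω)
            * ENNReal.ofReal (A (k + 1) ω) ^ (σ - 1) ∂P := by
        congr 1
        refine Finset.sum_congr rfl fun k _ => ?_
        rw [← lintegral_condExp_mul (ℱ.le k) (hz k) (hz0 k) (hAmeas k)]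
        refine lintegral_congr_ae ?_
        filter_upwards [hee k] with ω hω
        rw [hω]
    _ ≤ ENNReal.ofReal σ * ∑ k ∈ Finset.range n,
          ∫⁻ ω, ENNReal.ofReal ((D (k + 1) - D k) ω) * ENNReal.ofReal (A n ω) ^ (σ - 1) ∂P := by
        gcongr with k hk ω
        exact hAm ω (Finset.mem_range.1 hk)
    _ ≤ ENNReal.ofReal σ * ∫⁻ ω, ENNReal.ofReal (D n ω) * ENNReal.ofReal (A n ω) ^ (σ - 1) ∂P := by
        gcongr
        rw [← lintegral_finsetSum']
        · refine lintegral_mono fun ω => ?_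
          simp only
          rw [← Finset.sum_mul]
          refine mul_le_mul_left ?_ _
          have h1 : ∀ k ∈ Finset.range n, 0 ≤ (D (k + 1) - D k) ω := fun k _ =>
            sub_nonneg.2 (hDm ω k.le_succ)
          rw [← ENNReal.ofReal_sum_of_nonneg h1]
          refine ENNReal.ofReal_le_ofReal ?_
          simp only [Pi.sub_apply]
          rw [Finset.sum_range_sub (fun k => D k ω)]
          linarith [hD0 0 ω]
        · intro k _
          exact ((hz k).1.aemeasurable.ennreal_ofReal).mul
            (hAmem.1.aemeasurable.ennreal_ofReal.pow_const _)

end Compensator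

section Davis

variable {Ω X : Type*} {m0 : MeasurableSpace Ω} {P : Measure Ω} [IsProbabilityMeasure P]
  [NormedAddCommGroup X] [NormedSpace ℝ X] [CompleteSpace X] {ℱ : Filtration ℕ m0}

/-- Sums of centred increments form a martingale. -/
theorem martingale_sum_sub_condExp {y : ℕ → Ω → X}
    (hy : ∀ k, StronglyMeasurable[ℱ (k + 1)] (y k)) (hyi : ∀ k, Integrable (y k) P) :
    Martingale (fun n ω => ∑ k ∈ Finset.range n, (y k - P[y k | ℱ k]) ω) ℱ P := by
  refine martingale_of_condExp_sub_eq_zero_nat (fun n => ?_) (fun n => ?_) fun n => ?_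
  · refine Finset.stronglyMeasurable_fun_sum _ fun k hk => ?_
    have hkn : k + 1 ≤ n := Finset.mem_range.1 hk
    exact ((hy k).mono (ℱ.mono hkn)).sub
      (stronglyMeasurable_condExp.mono (ℱ.mono (k.le_succ.trans hkn)))
  · exact integrable_finsetSum _ fun k _ => (hyi k).sub integrable_condExp
  · have e : ((fun ω => ∑ k ∈ Finset.range (n + 1), (y k - P[y k | ℱ k]) ω)
        - fun ω => ∑ k ∈ Finset.range n, (y k - P[y k | ℱ k]) ω) = y n - P[y n | ℱ n] := by
      ext ω
      rw [Pi.sub_apply, Finset.sum_range_succ, add_sub_cancel_left]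
    rw [e]
    filter_upwards [condExp_sub (hyi n) integrable_condExp (ℱ n),
      ℱ.condExp_condExp (μ := P) (y n) (le_refl n)] with ω h1 h2
    rw [h1, Pi.sub_apply, h2, sub_self]
    rfl

/-- Davis' decomposition: a martingale `f` in `L_s` splits as `a + (f - a)`, where the increments
of the martingale `a` are dominated by `4 max_{j ≤ k} |df_j|`, and the increments of `f - a` are
absolutely summable in `L_s`. The increments of `a` are the centred truncations of those of `f` at
twice the running maximum of the previous ones; an increment above that level is at most twice the
increase of the running maximum. -/
theorem exists_davis_decomposition {s : ℝ≥0∞} (hs : 1 < s) (hs' : s < ∞) {f : ℕ → Ω → X}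
    (hf : Martingale f ℱ P) (hfs : ∀ k, MemLp (f k) s P) :
    ∃ a : ℕ → Ω → X, Martingale a ℱ P ∧ (∀ k, MemLp (a k) s P) ∧
      (∀ k, ∀ᵐ ω ∂P, ‖a (k + 1) ω - a k ω‖ ≤ 4 * maxNorm (martingaleDiff f) k ω) ∧
      ∀ n, eLpNorm (fun ω => ∑ k ∈ Finset.range (n + 1), ‖martingaleDiff (f - a) k ω‖) s P
        ≤ (2 + 2 * ENNReal.ofReal s.toReal) * eLpNorm (maxNorm (martingaleDiff f) n) s P := by
  set d := martingaleDiff f with hd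
  set D := maxNorm d with hD
  have hdad : StronglyAdapted ℱ d := martingaleDiff_stronglyAdapted hf.1
  have hds : ∀ k, MemLp (d k) s P := memLp_martingaleDiff hfs
  have hDad : StronglyAdapted ℱ D := maxNorm_stronglyAdapted hdad
  have hDs : ∀ k, MemLp (D k) s P := memLp_maxNorm hds
  have hDm : ∀ ω, Monotone fun k => D k ω := maxNorm_mono d
  have hD0 : ∀ k ω, 0 ≤ D k ω := maxNorm_nonneg d
  have hdi : ∀ k, Integrable (d k) P := fun k => (hds k).integrable hs.le
  have hDi : ∀ k, Integrable (D k) P := fun k => (hDs k).integrable hs.le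
  set G : ℕ → Set Ω := fun k => {ω | ‖d (k + 1) ω‖ ≤ 2 * D k ω} with hG
  have hGm : ∀ k, MeasurableSet[ℱ (k + 1)] (G k) := fun k =>
    measurableSet_le (mδ := ℱ (k + 1)) (hdad (k + 1)).norm.measurable
      (((hDad k).mono (ℱ.mono k.le_succ)).measurable.const_mul 2)
  set y : ℕ → Ω → X := fun k => (G k).indicator (d (k + 1)) with hy
  have hym : ∀ k, StronglyMeasurable[ℱ (k + 1)] (y k) := fun k =>
    (hdad (k + 1)).indicator (hGm k)
  have hys : ∀ k, MemLp (y k) s P := fun k => (hds (k + 1)).indicator (ℱ.le _ _ (hGm k))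
  have hyi : ∀ k, Integrable (y k) P := fun k => (hys k).integrable hs.le
  have hyle : ∀ k ω, ‖y k ω‖ ≤ 2 * D k ω := by
    intro k ω
    by_cases hω : ω ∈ G k
    · simp only [hy, Set.indicator_of_mem hω]; exact hω
    · simp only [hy, Set.indicator_of_notMem hω, norm_zero]; linarith [hD0 k ω]
  have hzle : ∀ k ω, ‖d (k + 1) ω - y k ω‖ ≤ 2 * (D (k + 1) ω - D k ω) := by
    intro k ω
    by_cases hω : ω ∈ G k
    · simp only [hy, Set.indicator_of_mem hω, sub_self, norm_zero]
      linarith [hDm ω k.le_succ]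
    · simp only [hy, Set.indicator_of_notMem hω, sub_zero]
      have h1 : 2 * D k ω < ‖d (k + 1) ω‖ := not_le.1 hω
      have h2 : ‖d (k + 1) ω‖ ≤ D (k + 1) ω := norm_le_maxNorm d le_rfl ω
      linarith
  set a : ℕ → Ω → X := fun n ω => ∑ k ∈ Finset.range n, (y k - P[y k | ℱ k]) ω with ha
  have hadiff : ∀ k ω, a (k + 1) ω - a k ω = y k ω - (P[y k | ℱ k]) ω := by
    intro k ω
    simp only [ha]
    rw [Finset.sum_range_succ, add_sub_cancel_left, Pi.sub_apply]
  refine ⟨a, martingale_sum_sub_condExp hym hyi, fun n => ?_, fun k => ?_, fun n => ?_⟩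
  · exact memLp_finsetSum _ fun k _ => (hys k).sub ((hys k).condExp hs.le)
  · have h1 : P[fun ω => ‖y k ω‖ | ℱ k] ≤ᵐ[P] P[fun ω => 2 * D k ω | ℱ k] :=
      condExp_mono (hyi k).norm ((hDi k).const_mul 2) (ae_of_all _ (hyle k))
    have h2 : P[fun ω => 2 * D k ω | ℱ k] = fun ω => 2 * D k ω :=
      condExp_of_stronglyMeasurable (ℱ.le k) ((hDad k).const_mul 2) ((hDi k).const_mul 2)
    filter_upwards [h1, norm_condExp_le (μ := P) (m := ℱ k) (y k)] with ω h1 h3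
    rw [h2] at h1
    rw [hadiff]
    have := norm_sub_le (y k ω) ((P[y k | ℱ k]) ω)
    linarith [hyle k ω]
  · have hincr : ∀ k, ∀ᵐ ω ∂P, ‖martingaleDiff (f - a) (k + 1) ω‖
        ≤ 2 * (D (k + 1) ω - D k ω) + 2 * (P[D (k + 1) - D k | ℱ k]) ω := by
      intro k
      have hzi : Integrable (d (k + 1) - y k) P := (hdi (k + 1)).sub (hyi k)
      have h0 : P[d (k + 1) | ℱ k] =ᵐ[P] 0 := by
        filter_upwards [condExp_sub (hf.integrable (k + 1)) (hf.integrable k) (ℱ k),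
          hf.2 k (k + 1) k.le_succ, hf.2 k k le_rfl] with ω h1 h2 h3
        exact h1.trans (by simp [h2, h3])
      have h1 := condExp_sub (hdi (k + 1)) (hyi k) (ℱ k)
      have h2 := norm_condExp_le (μ := P) (m := ℱ k) (d (k + 1) - y k)
      have h3 : P[fun ω => ‖(d (k + 1) - y k) ω‖ | ℱ k]
          ≤ᵐ[P] P[(2 : ℝ) • (D (k + 1) - D k) | ℱ k] :=
        condExp_mono hzi.norm (((hDi (k + 1)).sub (hDi k)).smul (2 : ℝ)) (ae_of_all _ (hzle k))
      have h4 := condExp_smul (μ := P) (2 : ℝ) (D (k + 1) - D k) (ℱ k)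
      filter_upwards [h0, h1, h2, h3, h4] with ω h0 h1 h2 h3 h4
      rw [h4] at h3
      have h5 : martingaleDiff (f - a) (k + 1) ω
          = (d (k + 1) ω - y k ω) - (P[d (k + 1) - y k | ℱ k]) ω := by
        have : martingaleDiff (f - a) (k + 1) ω
            = (f (k + 1) ω - f k ω) - (a (k + 1) ω - a k ω) := by
          simp only [martingaleDiff, Pi.sub_apply]; abel
        rw [this, hadiff, h1, Pi.sub_apply, h0]
        simp only [hd, martingaleDiff, Pi.sub_apply, Pi.zero_apply]
        abel
      rw [h5]
      have h6 := norm_sub_le (d (k + 1) ω - y k ω) ((P[d (k + 1) - y k | ℱ k]) ω)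
      have h7 : ‖(P[d (k + 1) - y k | ℱ k]) ω‖ ≤ 2 * (P[D (k + 1) - D k | ℱ k]) ω := h2.trans h3
      linarith [hzle k ω]
    set A : Ω → ℝ := fun ω => ∑ k ∈ Finset.range n, (P[D (k + 1) - D k | ℱ k]) ω with hA
    have hAle := eLpNorm_compensator_le hs hs' (ℱ := ℱ) hD0 hDm hDs n
    have hAm : AEStronglyMeasurable A P :=
      (integrable_finsetSum _ fun k _ => integrable_condExp).1
    have hB : ∀ᵐ ω ∂P, ‖∑ k ∈ Finset.range (n + 1), ‖martingaleDiff (f - a) k ω‖‖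
        ≤ ‖((2 : ℝ) • D n + (2 : ℝ) • A) ω‖ := by
      filter_upwards [ae_all_iff.2 hincr] with ω hω
      rw [Real.norm_of_nonneg (Finset.sum_nonneg fun _ _ => norm_nonneg _)]
      refine le_trans ?_ (le_abs_self _)
      rw [Finset.sum_range_succ']
      have h0 : ‖martingaleDiff (f - a) 0 ω‖ = D 0 ω := by
        simp [martingaleDiff, ha, hD, maxNorm, hd]
      have h1 := Finset.sum_le_sum fun k (_ : k ∈ Finset.range n) => hω k
      rw [Finset.sum_add_distrib, ← Finset.mul_sum, ← Finset.mul_sum,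
        Finset.sum_range_sub (fun k => D k ω)] at h1
      have h2 : ((2 : ℝ) • D n + (2 : ℝ) • A) ω
          = 2 * D n ω + 2 * ∑ k ∈ Finset.range n, (P[D (k + 1) - D k | ℱ k]) ω := rfl
      rw [h0, h2]
      linarith [hD0 0 ω]
    have h2 : ‖(2 : ℝ)‖ₑ = 2 := by
      rw [Real.enorm_of_nonneg (by norm_num)]; simp
    calc _ ≤ eLpNorm ((2 : ℝ) • D n + (2 : ℝ) • A) s P := eLpNorm_mono_ae hB
      _ ≤ eLpNorm ((2 : ℝ) • D n) s P + eLpNorm ((2 : ℝ) • A) s P :=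
        eLpNorm_add_le ((hDs n).1.const_smul _) (hAm.const_smul _) hs.le
      _ ≤ 2 * eLpNorm (D n) s P + 2 * (ENNReal.ofReal s.toReal * eLpNorm (D n) s P) := by
        rw [eLpNorm_const_smul, eLpNorm_const_smul, h2]
        gcongr
      _ = _ := by ring

end Davis

section Extrapolation

/-- A constant for the passage from the `UMD_r` to the `UMD_s` inequality; it does not depend on
`r`. -/
noncomputable def extrapolationConst (s : ℝ≥0∞) : ℝ≥0∞ :=
  (ENNReal.ofReal (36 * 3 ^ s.toReal) * (13 + 4 * ENNReal.ofReal s.toReal)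
    + (4 + 4 * ENNReal.ofReal s.toReal)) * ENNReal.ofReal (s.toReal / (s.toReal - 1))

theorem extrapolationConst_ne_top (s : ℝ≥0∞) : extrapolationConst s ≠ ∞ := by
  unfold extrapolationConst
  finiteness

theorem one_le_extrapolationConst {s : ℝ≥0∞} (hs : 1 < s) (hs' : s < ∞) :
    1 ≤ extrapolationConst s := by
  have hσ := one_lt_toReal hs hs'
  have h1 : (1 : ℝ≥0∞) ≤ ENNReal.ofReal (s.toReal / (s.toReal - 1)) := by
    rw [ENNReal.one_le_ofReal, le_div_iff₀ (by linarith)]; linarith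
  calc (1 : ℝ≥0∞) = 1 * 1 := by ring
    _ ≤ extrapolationConst s := by
      unfold extrapolationConst
      gcongr
      calc (1 : ℝ≥0∞) ≤ 4 := by norm_num
        _ ≤ 4 + 4 * ENNReal.ofReal s.toReal := le_self_add
        _ ≤ _ := le_add_self

variable {X : Type*} [NormedAddCommGroup X] [NormedSpace ℝ X] [CompleteSpace X]

/-- Extrapolation of the `UMD` inequality from one exponent to another, with linear dependence on
the constant. -/
theorem IsUMDBound.extrapolate {r s : ℝ≥0∞} (hr : 1 < r) (hr' : r < ∞) (hs : 1 < s) (hs' : s < ∞)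
    {C : ℝ≥0} (hC1 : 1 ≤ C) (hC : IsUMDBound r X C) :
    IsUMDBound s X (extrapolationConst s * C) := by
  intro Ω m0 P _ ℱ f hf hfs n ε hε
  simp only [sum_range_martingaleDiff]
  obtain ⟨a, ha, has, haD, hb⟩ := exists_davis_decomposition hs hs' hf hfs
  set D := maxNorm (martingaleDiff f) with hD
  set B : Ω → ℝ := fun ω => ∑ k ∈ Finset.range (n + 1), ‖martingaleDiff (f - a) k ω‖ with hB
  set M := eLpNorm (maxNorm f n) s P with hM
  have hDad : StronglyAdapted ℱ D :=
    maxNorm_stronglyAdapted (martingaleDiff_stronglyAdapted hf.1)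
  have hDs : MemLp (D n) s P := memLp_maxNorm (memLp_martingaleDiff hfs) n
  have hbs : ∀ k, MemLp ((f - a) k) s P := fun k => (hfs k).sub (has k)
  have hBs : MemLp B s P := memLp_finsetSum _ fun k _ => (memLp_martingaleDiff hbs k).norm
  have hB0 : ∀ ω, 0 ≤ B ω := fun ω => Finset.sum_nonneg fun _ _ => norm_nonneg _
  have hDM : eLpNorm (D n) s P ≤ 2 * M := by
    have h1 : eLpNorm (D n) s P ≤ eLpNorm ((2 : ℝ) • maxNorm f n) s P := by
      refine eLpNorm_mono fun ω => ?_
      rw [Real.norm_of_nonneg (maxNorm_nonneg _ n ω)]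
      exact (maxNorm_martingaleDiff_le f n ω).trans (le_abs_self _)
    refine h1.trans_eq ?_
    rw [eLpNorm_const_smul, Real.enorm_of_nonneg (by norm_num)]
    simp [hM]
  have hBM : eLpNorm B s P ≤ (4 + 4 * ENNReal.ofReal s.toReal) * M :=
    calc eLpNorm B s P ≤ (2 + 2 * ENNReal.ofReal s.toReal) * eLpNorm (D n) s P := hb n
      _ ≤ (2 + 2 * ENNReal.ofReal s.toReal) * (2 * M) := by gcongr
      _ = _ := by ring
  have hmaxM : eLpNorm (fun ω => max (maxNorm a n ω) (4 * D n ω)) s P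
      ≤ (13 + 4 * ENNReal.ofReal s.toReal) * M := by
    have h1 : eLpNorm (fun ω => max (maxNorm a n ω) (4 * D n ω)) s P
        ≤ eLpNorm (maxNorm f n + B + (4 : ℝ) • D n) s P := by
      refine eLpNorm_mono fun ω => ?_
      rw [Real.norm_of_nonneg ((maxNorm_nonneg a n ω).trans (le_max_left _ _))]
      refine le_trans ?_ (le_abs_self _)
      simp only [Pi.add_apply, Pi.smul_apply, smul_eq_mul]
      have hD0 := maxNorm_nonneg (martingaleDiff f) n ω
      have hf0 := maxNorm_nonneg f n ω
      have hab : maxNorm a n ω ≤ maxNorm f n ω + B ω := by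
        refine maxNorm_le fun k hk => ?_
        have h2 : ‖(f - a) k ω‖ ≤ B ω := by
          rw [← sum_range_martingaleDiff (f - a) k ω]
          refine (norm_sum_le _ _).trans ?_
          exact Finset.sum_le_sum_of_subset_of_nonneg
            (Finset.range_subset_range.2 (by omega)) fun _ _ _ => norm_nonneg _
        have h3 : ‖a k ω‖ ≤ ‖f k ω‖ + ‖(f - a) k ω‖ := by
          have := norm_sub_le (f k ω) ((f - a) k ω)
          simpa using this
        exact h3.trans (add_le_add (norm_le_maxNorm f hk ω) h2)
      exact max_le (by linarith) (by linarith [hB0 ω])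
    have h4 : ‖(4 : ℝ)‖ₑ = 4 := by rw [Real.enorm_of_nonneg (by norm_num)]; simp
    have hfm := (memLp_maxNorm hfs n).1
    calc _ ≤ _ := h1
      _ ≤ eLpNorm (maxNorm f n) s P + eLpNorm B s P + eLpNorm ((4 : ℝ) • D n) s P :=
        (eLpNorm_add_le (hfm.add hBs.1) (hDs.1.const_smul _) hs.le).trans
          (add_le_add_left (eLpNorm_add_le hfm hBs.1 hs.le) _)
      _ ≤ M + (4 + 4 * ENNReal.ofReal s.toReal) * M + 4 * (2 * M) := by
        rw [eLpNorm_const_smul, h4]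
        gcongr
      _ = _ := by ring
  have hgood := eLpNorm_maxNorm_signTransform_le hr hr' hs hs' hC1 hC ha has
    (w := fun k ω => 4 * D k ω) (fun k => (hDad k).const_mul 4)
    (fun ω i j hij => by
      have := maxNorm_mono (martingaleDiff f) ω hij
      simp only at this ⊢
      linarith) haD hε n
  have hsplit : eLpNorm (fun ω => ∑ k ∈ Finset.range (n + 1), ε k • martingaleDiff f k ω) s P
      ≤ eLpNorm (maxNorm (signTransform ε a) n + B) s P := by
    refine eLpNorm_mono fun ω => ?_
    refine le_trans ?_ (le_abs_self _)
    have h1 : ∑ k ∈ Finset.range (n + 1), ε k • martingaleDiff f k ω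
        = signTransform ε a n ω
          + ∑ k ∈ Finset.range (n + 1), ε k • martingaleDiff (f - a) k ω := by
      simp only [signTransform]
      rw [← Finset.sum_add_distrib]
      refine Finset.sum_congr rfl fun k _ => ?_
      rw [← smul_add]
      congr 1
      cases k <;> simp only [martingaleDiff, Pi.sub_apply] <;> abel
    rw [h1, Pi.add_apply]
    refine (norm_add_le _ _).trans (add_le_add (norm_le_maxNorm _ le_rfl ω) ?_)
    refine (norm_sum_le _ _).trans (le_of_eq ?_)
    exact Finset.sum_congr rfl fun k _ => norm_smul_of_sign (hε k) _
  have hdoob := eLpNorm_maxNorm_le hs hs' hf hfs n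
  have hC1' : (1 : ℝ≥0∞) ≤ C := by exact_mod_cast hC1
  calc _ ≤ _ := hsplit
    _ ≤ eLpNorm (maxNorm (signTransform ε a) n) s P + eLpNorm B s P :=
      eLpNorm_add_le (memLp_maxNorm (memLp_signTransform has) n).1 hBs.1 hs.le
    _ ≤ ENNReal.ofReal (36 * 3 ^ s.toReal) * C * ((13 + 4 * ENNReal.ofReal s.toReal) * M)
        + C * ((4 + 4 * ENNReal.ofReal s.toReal) * M) := by
      refine add_le_add (hgood.trans (mul_le_mul_right hmaxM _)) (hBM.trans ?_)
      exact le_mul_of_one_le_left zero_le hC1'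
    _ = (ENNReal.ofReal (36 * 3 ^ s.toReal) * (13 + 4 * ENNReal.ofReal s.toReal)
        + (4 + 4 * ENNReal.ofReal s.toReal)) * C * M := by ring
    _ ≤ (ENNReal.ofReal (36 * 3 ^ s.toReal) * (13 + 4 * ENNReal.ofReal s.toReal)
        + (4 + 4 * ENNReal.ofReal s.toReal)) * C
          * (ENNReal.ofReal (s.toReal / (s.toReal - 1)) * eLpNorm (f n) s P) := by gcongr
    _ = _ := by unfold extrapolationConst; ring

end Extrapolation

/-! ### Hilbert spaces and finite `ℓ_r`-sums -/

section Hilbert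

variable {H : Type*} [NormedAddCommGroup H] [InnerProductSpace ℝ H] {Ω : Type*}
  {m0 : MeasurableSpace Ω} {P : Measure Ω} {ℱ : Filtration ℕ m0} {f : ℕ → Ω → H}

theorem integrable_inner_of_memLp {g h : Ω → H} (hg : MemLp g 2 P) (hh : MemLp h 2 P) :
    Integrable (fun ω => inner ℝ (g ω) (h ω)) P :=
  (hg.norm.integrable_mul hh.norm).mono' (hg.1.inner hh.1)
    (ae_of_all _ fun _ => norm_inner_le_norm _ _)

variable [CompleteSpace H] [IsProbabilityMeasure P]

/-- Martingale differences are orthogonal to the past. -/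
theorem integral_inner_martingaleDiff (hf : Martingale f ℱ P) (hf2 : ∀ k, MemLp (f k) 2 P) {n : ℕ}
    {g : Ω → H} (hg : StronglyMeasurable[ℱ n] g) (hg2 : MemLp g 2 P) :
    ∫ ω, inner ℝ (g ω) (martingaleDiff f (n + 1) ω) ∂P = 0 := by
  have hd2 := memLp_martingaleDiff hf2 (n + 1)
  have h0 : P[martingaleDiff f (n + 1) | ℱ n] =ᵐ[P] 0 := by
    filter_upwards [condExp_sub (hf.integrable (n + 1)) (hf.integrable n) (ℱ n),
      hf.2 n (n + 1) n.le_succ, hf.2 n n le_rfl] with ω h1 h2 h3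
    exact h1.trans (by simp [h2, h3])
  have h1 := condExp_bilin_of_stronglyMeasurable_left (innerSL ℝ (E := H)) hg
    (integrable_inner_of_memLp hg2 hd2) (hd2.integrable (by norm_num))
  rw [← integral_condExp (ℱ.le n)]
  refine integral_eq_zero_of_ae ?_
  filter_upwards [h0, h1] with ω h0 h1
  refine h1.trans ?_
  rw [h0]
  simp

/-- The Pythagorean identity; the right-hand side does not depend on the signs. -/
theorem integral_norm_sq_signTransform (hf : Martingale f ℱ P) (hf2 : ∀ k, MemLp (f k) 2 P)
    {ε : ℕ → ℝ} (hε : ∀ k, ε k = 1 ∨ ε k = -1) (n : ℕ) :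
    ∫ ω, ‖signTransform ε f n ω‖ ^ 2 ∂P
      = ∑ k ∈ Finset.range (n + 1), ∫ ω, ‖martingaleDiff f k ω‖ ^ 2 ∂P := by
  induction n with
  | zero => simp [signTransform, norm_smul_of_sign (hε 0)]
  | succ n ih =>
    rw [Finset.sum_range_succ, ← ih]
    have hg2 := memLp_signTransform (ε := ε) hf2 n
    have hd2 := memLp_martingaleDiff hf2 (n + 1)
    have e : ∀ ω, ‖signTransform ε f (n + 1) ω‖ ^ 2 = (‖signTransform ε f n ω‖ ^ 2
        + 2 * ε (n + 1) * inner ℝ (signTransform ε f n ω) (martingaleDiff f (n + 1) ω))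
        + ‖martingaleDiff f (n + 1) ω‖ ^ 2 := by
      intro ω
      have : signTransform ε f (n + 1) ω
          = signTransform ε f n ω + ε (n + 1) • martingaleDiff f (n + 1) ω :=
        Finset.sum_range_succ _ _
      rw [this, norm_add_sq_real, inner_smul_right, norm_smul_of_sign (hε _)]
      ring
    simp only [e]
    have i1 := hg2.norm.integrable_sq
    have i2 := (integrable_inner_of_memLp hg2 hd2).const_mul (2 * ε (n + 1))
    have i3 := hd2.norm.integrable_sq
    have i12 : Integrable (fun ω => ‖signTransform ε f n ω‖ ^ 2
        + 2 * ε (n + 1) * inner ℝ (signTransform ε f n ω) (martingaleDiff f (n + 1) ω)) P :=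
      i1.add i2
    rw [integral_add i12 i3, integral_add i1 i2, integral_const_mul,
      integral_inner_martingaleDiff hf hf2 (signTransform_stronglyAdapted hf.1 n) hg2, mul_zero,
      add_zero]

theorem isUMDBound_two_of_innerProductSpace : IsUMDBound 2 H 1 := by
  intro Ω m0 P _ ℱ f hf hf2 n ε hε
  have key : ∀ {ε : ℕ → ℝ}, (∀ k, ε k = 1 ∨ ε k = -1) →
      eLpNorm (signTransform ε f n) 2 P = ENNReal.ofReal
        ((∑ k ∈ Finset.range (n + 1), ∫ ω, ‖martingaleDiff f k ω‖ ^ 2 ∂P) ^ (2 : ℝ)⁻¹) := by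
    intro ε hε
    rw [(memLp_signTransform hf2 n).eLpNorm_eq_integral_rpow_norm (by norm_num) (by norm_num),
      ← integral_norm_sq_signTransform hf hf2 hε n]
    simp
  have e : (fun ω => ∑ k ∈ Finset.range (n + 1), martingaleDiff f k ω)
      = signTransform (fun _ => 1) f n := by
    ext ω; simp [signTransform]
  rw [one_mul, e, key fun _ => Or.inl rfl]
  exact (key hε).le

end Hilbert

section PiLp

/-- The image of a martingale under a continuous linear map is a martingale. -/
theorem MeasureTheory.Martingale.continuousLinearMap_comp {Ω X Y : Type*} {m0 : MeasurableSpace Ω}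
    {P : Measure Ω} [NormedAddCommGroup X] [NormedSpace ℝ X] [CompleteSpace X]
    [NormedAddCommGroup Y] [NormedSpace ℝ Y] [CompleteSpace Y] {ℱ : Filtration ℕ m0}
    {f : ℕ → Ω → X} (hf : Martingale f ℱ P) (L : X →L[ℝ] Y) :
    Martingale (fun k ω => L (f k ω)) ℱ P := by
  refine ⟨fun k => L.continuous.comp_stronglyMeasurable (hf.1 k), fun i j hij => ?_⟩
  filter_upwards [hf.2 i j hij, L.comp_condExp_comm (m := ℱ i) (hf.integrable j)] with ω h1 h2
  rw [← h1]
  exact h2.symm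

variable {ι : Type*} [Fintype ι] {Z : Type*} [NormedAddCommGroup Z] [NormedSpace ℝ Z]

theorem lintegral_enorm_piLp {Ω : Type*} {m0 : MeasurableSpace Ω} {P : Measure Ω} {r : ℝ≥0∞}
    [Fact (1 ≤ r)] (hr : 1 < r) (hr' : r < ∞) {g : Ω → PiLp r fun _ : ι => Z} (hg : MemLp g r P) :
    ∫⁻ ω, ‖g ω‖ₑ ^ r.toReal ∂P = ∑ i, ∫⁻ ω, ‖g ω i‖ₑ ^ r.toReal ∂P := by
  have hρ := one_lt_toReal hr hr'
  rw [← lintegral_finsetSum']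
  · refine lintegral_congr fun ω => ?_
    rw [enorm_eq_nnnorm, PiLp.nnnorm_eq_sum hr'.ne, ← ENNReal.coe_rpow_of_nonneg _ (by linarith),
      ← NNReal.rpow_mul, one_div_mul_cancel (by linarith), NNReal.rpow_one]
    push_cast
    refine Finset.sum_congr rfl fun i _ => ?_
    rw [ENNReal.coe_rpow_of_nonneg _ (by linarith)]
    rfl
  · intro i _
    exact ((PiLp.proj r (𝕜 := ℝ) (fun _ : ι => Z) i).continuous.comp_aestronglyMeasurable
      hg.1).enorm.pow_const _

/-- The `UMD_r` inequality passes to finite `ℓ_r`-sums, coordinate by coordinate. -/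
theorem IsUMDBound.piLp [CompleteSpace Z] {r : ℝ≥0∞} [Fact (1 ≤ r)] (hr : 1 < r) (hr' : r < ∞)
    {C : ℝ≥0∞} (hC : IsUMDBound r Z C) : IsUMDBound r (PiLp r fun _ : ι => Z) C := by
  intro Ω m0 P _ ℱ f hf hfr n ε hε
  have hρ := one_lt_toReal hr hr'
  have hr0 : r ≠ 0 := by positivity
  have hmem1 := memLp_signTransform (ε := ε) hfr n
  simp only [sum_range_martingaleDiff]
  have hdiff : ∀ i k ω, martingaleDiff (fun k ω => f k ω i) k ω = martingaleDiff f k ω i := by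
    intro i k ω
    cases k <;> simp [martingaleDiff]
  have hcoord : ∀ i, ∫⁻ ω, ‖signTransform ε f n ω i‖ₑ ^ r.toReal ∂P
      ≤ C ^ r.toReal * ∫⁻ ω, ‖f n ω i‖ₑ ^ r.toReal ∂P := by
    intro i
    set L := PiLp.proj r (𝕜 := ℝ) (fun _ : ι => Z) i with hL
    have h1 := hC Ω m0 P inferInstance ℱ (fun k ω => f k ω i)
      (hf.continuousLinearMap_comp L) (fun k => L.comp_memLp' (hfr k)) n ε hε
    simp only [sum_range_martingaleDiff] at h1
    rw [eLpNorm_eq_lintegral_rpow_enorm_toReal hr0 hr'.ne,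
      eLpNorm_eq_lintegral_rpow_enorm_toReal hr0 hr'.ne] at h1
    have h2 := ENNReal.rpow_le_rpow h1 (show (0 : ℝ) ≤ r.toReal by linarith)
    rw [ENNReal.mul_rpow_of_nonneg _ _ (by linarith), ← ENNReal.rpow_mul, ← ENNReal.rpow_mul,
      one_div_mul_cancel (by linarith), ENNReal.rpow_one, ENNReal.rpow_one] at h2
    have e : ∀ ω, signTransform ε f n ω i
        = ∑ k ∈ Finset.range (n + 1), ε k • martingaleDiff (fun k ω => f k ω i) k ω := by
      intro ω
      simp only [hdiff, signTransform]
      exact (map_sum L _ _).trans (Finset.sum_congr rfl fun k _ => map_smul L _ _)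
    simpa only [e] using h2
  have hfin : ∫⁻ ω, ‖signTransform ε f n ω‖ₑ ^ r.toReal ∂P
      ≤ C ^ r.toReal * ∫⁻ ω, ‖f n ω‖ₑ ^ r.toReal ∂P := by
    rw [lintegral_enorm_piLp hr hr' hmem1, lintegral_enorm_piLp hr hr' (hfr n), Finset.mul_sum]
    exact Finset.sum_le_sum fun i _ => hcoord i
  rw [eLpNorm_eq_lintegral_rpow_enorm_toReal hr0 hr'.ne,
    eLpNorm_eq_lintegral_rpow_enorm_toReal hr0 hr'.ne]
  have h3 := ENNReal.rpow_le_rpow hfin (show (0 : ℝ) ≤ 1 / r.toReal by positivity)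
  rwa [ENNReal.mul_rpow_of_nonneg _ _ (by positivity), ← ENNReal.rpow_mul,
    mul_one_div_cancel (by linarith), ENNReal.rpow_one] at h3

end PiLp

/-! ### Bochner spaces -/

section JointRep

open Filter Topology

variable {Ω T Z : Type*} {mΩ : MeasurableSpace Ω} {mT : MeasurableSpace T} {P : Measure Ω}
  {ν : Measure T} [NormedAddCommGroup Z] {r : ℝ≥0∞}

/-- `F : Ω × T → Z` represents `f : Ω → L_r(T; Z)`: almost every section `F (ω, ·)` is a
representative of the class `f ω`. -/
def IsJointRep (P : Measure Ω) (F : Ω × T → Z) (f : Ω → Lp Z r ν) : Prop :=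
  ∀ᵐ ω ∂P, (fun t => F (ω, t)) =ᵐ[ν] f ω

theorem IsJointRep.add {F G : Ω × T → Z} {f g : Ω → Lp Z r ν} (hF : IsJointRep P F f)
    (hG : IsJointRep P G g) : IsJointRep P (F + G) (f + g) := by
  filter_upwards [hF, hG] with ω h1 h2
  filter_upwards [h1, h2, Lp.coeFn_add (f ω) (g ω)] with t h1 h2 h3
  rw [Pi.add_apply, Pi.add_apply, h3, h1, h2, Pi.add_apply]

theorem IsJointRep.sub {F G : Ω × T → Z} {f g : Ω → Lp Z r ν} (hF : IsJointRep P F f)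
    (hG : IsJointRep P G g) : IsJointRep P (F - G) (f - g) := by
  filter_upwards [hF, hG] with ω h1 h2
  filter_upwards [h1, h2, Lp.coeFn_sub (f ω) (g ω)] with t h1 h2 h3
  rw [Pi.sub_apply, Pi.sub_apply, h3, h1, h2, Pi.sub_apply]

theorem IsJointRep.const_smul [NormedSpace ℝ Z] {F : Ω × T → Z} {f : Ω → Lp Z r ν}
    (hF : IsJointRep P F f) (c : ℝ) : IsJointRep P (c • F) (c • f) := by
  filter_upwards [hF] with ω h1
  filter_upwards [h1, Lp.coeFn_smul c (f ω)] with t h1 h3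
  rw [Pi.smul_apply, Pi.smul_apply, h3, h1, Pi.smul_apply]

theorem isJointRep_martingaleDiff {F : ℕ → Ω × T → Z} {f : ℕ → Ω → Lp Z r ν}
    (h : ∀ k, IsJointRep P (F k) (f k)) (k : ℕ) :
    IsJointRep P (martingaleDiff F k) (martingaleDiff f k) := by
  cases k with
  | zero => exact h 0
  | succ k => exact (h (k + 1)).sub (h k)

theorem isJointRep_signTransform [NormedSpace ℝ Z] {F : ℕ → Ω × T → Z} {f : ℕ → Ω → Lp Z r ν}
    (h : ∀ k, IsJointRep P (F k) (f k)) (ε : ℕ → ℝ) (n : ℕ) :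
    IsJointRep P (signTransform ε F n) (signTransform ε f n) := by
  induction n with
  | zero =>
    have e1 : signTransform ε F 0 = ε 0 • martingaleDiff F 0 := by
      ext; simp [signTransform]
    have e2 : signTransform ε f 0 = ε 0 • martingaleDiff f 0 := by
      funext ω; simp [signTransform]
    rw [e1, e2]
    exact (isJointRep_martingaleDiff h 0).const_smul _
  | succ n ih =>
    have e1 : signTransform ε F (n + 1)
        = signTransform ε F n + ε (n + 1) • martingaleDiff F (n + 1) :=
      funext fun _ => Finset.sum_range_succ _ _
    have e2 : signTransform ε f (n + 1)
        = signTransform ε f n + ε (n + 1) • martingaleDiff f (n + 1) :=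
      funext fun _ => Finset.sum_range_succ _ _
    rw [e1, e2]
    exact ih.add ((isJointRep_martingaleDiff h (n + 1)).const_smul _)

variable [SFinite ν]

theorem IsJointRep.eLpNorm_eq [SFinite P] (hr0 : r ≠ 0) (hr' : r ≠ ∞) {F : Ω × T → Z}
    {f : Ω → Lp Z r ν} (h : IsJointRep P F f) (hF : AEStronglyMeasurable F (P.prod ν)) :
    eLpNorm F r (P.prod ν) = eLpNorm f r P := by
  have hρ : 0 < r.toReal := ENNReal.toReal_pos hr0 hr'
  rw [eLpNorm_eq_lintegral_rpow_enorm_toReal hr0 hr',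
    eLpNorm_eq_lintegral_rpow_enorm_toReal hr0 hr',
    lintegral_prod _ (hF.enorm.pow_const _)]
  congr 1
  refine lintegral_congr_ae ?_
  filter_upwards [h] with ω hω
  rw [Lp.enorm_def, ← eLpNorm_congr_ae hω, eLpNorm_eq_lintegral_rpow_enorm_toReal hr0 hr',
    ← ENNReal.rpow_mul, one_div_mul_cancel hρ.ne', ENNReal.rpow_one]

theorem IsJointRep.memLp [SFinite P] [Fact (1 ≤ r)] (hr0 : r ≠ 0) (hr' : r ≠ ∞) {F : Ω × T → Z}
    {f : Ω → Lp Z r ν} (h : IsJointRep P F f) (hF : AEStronglyMeasurable F (P.prod ν))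
    (hf : MemLp f r P) : MemLp F r (P.prod ν) :=
  ⟨hF, by rw [h.eLpNorm_eq hr0 hr' hF]; exact hf.2⟩

/-- Representability passes to limits in `L_r`. If `F` is the limit of the representatives `F_j` of
`f_j`, then the `r`-th power of the distance between a section `F (ω, ·)` and `f ω` is dominated by
the sum of a measurable function measuring `F - F_j` and one measuring `f_j - f`; the infimum of
these bounds over `j` has integral zero. -/
theorem isJointRep_of_tendsto [SFinite P] [Fact (1 ≤ r)] (hr : 1 < r) (hr' : r < ∞)
    {F : Ω × T → Z} (hF : StronglyMeasurable F) {f : Ω → Lp Z r ν} (hf : AEStronglyMeasurable f P)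
    {Fs : ℕ → Ω × T → Z} {fs : ℕ → Ω → Lp Z r ν} (hFs : ∀ j, StronglyMeasurable (Fs j))
    (hfs : ∀ j, AEStronglyMeasurable (fs j) P) (hrep : ∀ j, IsJointRep P (Fs j) (fs j))
    (hlimF : Tendsto (fun j => eLpNorm (F - Fs j) r (P.prod ν)) atTop (𝓝 0))
    (hlimf : Tendsto (fun j => eLpNorm (fs j - f) r P) atTop (𝓝 0)) : IsJointRep P F f := by
  have hρ : 1 < r.toReal := one_lt_toReal hr hr'
  have hr0 : r ≠ 0 := by positivity
  have hρ0 : (0 : ℝ) < r.toReal := by linarith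
  set U : ℕ → Ω → ℝ≥0∞ := fun j ω => ∫⁻ t, ‖(F - Fs j) (ω, t)‖ₑ ^ r.toReal ∂ν with hU
  set W : ℕ → Ω → ℝ≥0∞ := fun j ω => ‖(fs j - f) ω‖ₑ ^ r.toReal with hW
  have hpow : ∀ (x : ℕ → ℝ≥0∞), Tendsto x atTop (𝓝 0) →
      Tendsto (fun j => x j ^ r.toReal) atTop (𝓝 0) := fun x hx => by
    have := (ENNReal.continuous_rpow_const (y := r.toReal)).tendsto 0
    rw [ENNReal.zero_rpow_of_pos hρ0] at this
    exact this.comp hx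
  have hUm : ∀ j, AEMeasurable (U j) P := fun j =>
    (((hF.sub (hFs j)).enorm.pow_const _).lintegral_prod_right').aemeasurable
  have hWm : ∀ j, AEMeasurable (W j) P := fun j => ((hfs j).sub hf).enorm.pow_const _
  have hUint : ∀ j, ∫⁻ ω, U j ω ∂P = eLpNorm (F - Fs j) r (P.prod ν) ^ r.toReal := fun j => by
    rw [eLpNorm_eq_lintegral_rpow_enorm_toReal hr0 hr'.ne, ← ENNReal.rpow_mul,
      one_div_mul_cancel hρ0.ne', ENNReal.rpow_one,
      lintegral_prod _ ((hF.sub (hFs j)).enorm.pow_const _).aemeasurable]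
  have hWint : ∀ j, ∫⁻ ω, W j ω ∂P = eLpNorm (fs j - f) r P ^ r.toReal := fun j => by
    rw [eLpNorm_eq_lintegral_rpow_enorm_toReal hr0 hr'.ne, ← ENNReal.rpow_mul,
      one_div_mul_cancel hρ0.ne', ENNReal.rpow_one]
  have hzero : ∫⁻ ω, ⨅ j, (U j ω + W j ω) ∂P = 0 := by
    have h1 : Tendsto (fun j => ∫⁻ ω, U j ω ∂P + ∫⁻ ω, W j ω ∂P) atTop (𝓝 (0 + 0)) := by
      simp only [hUint, hWint]
      exact (hpow _ hlimF).add (hpow _ hlimf)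
    rw [add_zero] at h1
    refine le_antisymm (ge_of_tendsto' h1 fun j => ?_) zero_le
    rw [← lintegral_add_left' (hUm j)]
    exact lintegral_mono fun ω => iInf_le _ j
  have hm : AEMeasurable (fun ω => ⨅ j, (U j ω + W j ω)) P :=
    AEMeasurable.iInf fun j => (hUm j).add (hWm j)
  rw [lintegral_eq_zero_iff' hm] at hzero
  filter_upwards [hzero, ae_all_iff.2 hrep] with ω hω hrepω
  have hsec : StronglyMeasurable fun t => F (ω, t) := hF.comp_measurable measurable_prodMk_left
  have hle : ∀ j, eLpNorm (fun t => F (ω, t) - f ω t) r ν ^ r.toReal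
      ≤ 2 ^ (r.toReal - 1) * (U j ω + W j ω) := by
    intro j
    have hsecj : StronglyMeasurable fun t => (F - Fs j) (ω, t) :=
      (hF.sub (hFs j)).comp_measurable measurable_prodMk_left
    have h1 : (fun t => F (ω, t) - f ω t)
        =ᵐ[ν] (fun t => (F - Fs j) (ω, t)) + ((fs j - f) ω : Lp Z r ν) := by
      filter_upwards [hrepω j, Lp.coeFn_sub (fs j ω) (f ω)] with t h2 h3
      have h4 : ((fs j - f) ω : Lp Z r ν) t = (fs j ω : T → Z) t - (f ω : T → Z) t := h3
      rw [Pi.add_apply, h4, Pi.sub_apply, ← h2]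
      abel
    have h4 : U j ω = eLpNorm (fun t => (F - Fs j) (ω, t)) r ν ^ r.toReal := by
      rw [eLpNorm_eq_lintegral_rpow_enorm_toReal hr0 hr'.ne, ← ENNReal.rpow_mul,
        one_div_mul_cancel hρ0.ne', ENNReal.rpow_one]
    have h5 : W j ω = eLpNorm ((fs j - f) ω) r ν ^ r.toReal := by
      simp only [hW, Lp.enorm_def]
    rw [eLpNorm_congr_ae h1, h4, h5]
    refine le_trans (ENNReal.rpow_le_rpow (eLpNorm_add_le hsecj.aestronglyMeasurable
      (Lp.aestronglyMeasurable _) hr.le) hρ0.le) ?_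
    exact ENNReal.rpow_add_le_mul_rpow_add_rpow _ _ hρ.le
  have hz : eLpNorm (fun t => F (ω, t) - f ω t) r ν ^ r.toReal ≤ 0 := by
    have h1 : eLpNorm (fun t => F (ω, t) - f ω t) r ν ^ r.toReal
        ≤ 2 ^ (r.toReal - 1) * ⨅ j, (U j ω + W j ω) := by
      rw [ENNReal.mul_iInf_of_ne (by simp) (by simp)]
      exact le_iInf hle
    rw [hω] at h1
    simpa using h1
  have hz' : eLpNorm (fun t => F (ω, t) - f ω t) r ν = 0 :=
    (ENNReal.rpow_eq_zero_iff_of_pos hρ0).1 (le_antisymm hz zero_le)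
  have h5 := (eLpNorm_eq_zero_iff (hsec.aestronglyMeasurable.sub (Lp.aestronglyMeasurable _)) hr0).1
    hz'
  filter_upwards [h5] with t ht
  exact sub_eq_zero.1 ht

/-- Every `f ∈ L_r(Ω; L_r(T; Z))` has a jointly measurable representative. -/
theorem exists_isJointRep [CompleteSpace Z] [SFinite P] [Fact (1 ≤ r)] (hr : 1 < r) (hr' : r < ∞)
    {f : Ω → Lp Z r ν} (hf : MemLp f r P) :
    ∃ F : Ω × T → Z, StronglyMeasurable F ∧ IsJointRep P F f := by
  have hr0 : r ≠ 0 := by positivity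
  refine MemLp.induction hr'.ne
    (fun f : Ω → Lp Z r ν => ∃ F : Ω × T → Z, StronglyMeasurable F ∧ IsJointRep P F f)
    (fun c s hs _ => ?_) (fun f g _ _ _ hF hG => ?_) ?_ (fun f g hfg _ hF => ?_) hf
  · refine ⟨(s ×ˢ Set.univ).indicator fun z => c z.2,
      ((Lp.stronglyMeasurable c).comp_measurable measurable_snd).indicator
        (hs.prod MeasurableSet.univ), ae_of_all _ fun ω => ?_⟩
    by_cases hω : ω ∈ s
    · simp [hω, Set.indicator]
    · simp only [Set.indicator, hω, Set.mem_prod, false_and, if_false]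
      exact (Lp.coeFn_zero Z r ν).symm
  · obtain ⟨F, hFm, hF⟩ := hF
    obtain ⟨G, hGm, hG⟩ := hG
    exact ⟨F + G, hFm.add hGm, hF.add hG⟩
  · refine IsSeqClosed.isClosed fun fs f hfs hlim => ?_
    choose Fs hFsm hFs using hfs
    have hmem : ∀ j, MemLp (Fs j) r (P.prod ν) := fun j =>
      (hFs j).memLp hr0 hr'.ne (hFsm j).aestronglyMeasurable (Lp.memLp (fs j))
    have hedist : ∀ i j, edist ((hmem i).toLp (Fs i)) ((hmem j).toLp (Fs j))
        = edist (fs i) (fs j) := by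
      intro i j
      rw [Lp.edist_toLp_toLp, Lp.edist_def]
      exact ((hFs i).sub (hFs j)).eLpNorm_eq hr0 hr'.ne
        ((hFsm i).sub (hFsm j)).aestronglyMeasurable
    have hcauchy : CauchySeq fun j => (hmem j).toLp (Fs j) := by
      rw [EMetric.cauchySeq_iff]
      have := EMetric.cauchySeq_iff.1 hlim.cauchySeq
      simpa only [hedist] using this
    obtain ⟨G, hG⟩ := cauchySeq_tendsto_of_complete hcauchy
    refine ⟨G, Lp.stronglyMeasurable G, isJointRep_of_tendsto hr hr' (Lp.stronglyMeasurable G)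
      (Lp.aestronglyMeasurable f) hFsm (fun j => Lp.aestronglyMeasurable (fs j)) hFs ?_ ?_⟩
    · have h1 := tendsto_iff_edist_tendsto_0.1 hG
      refine h1.congr fun j => ?_
      rw [edist_comm, Lp.edist_def]
      refine eLpNorm_congr_ae ?_
      filter_upwards [(hmem j).coeFn_toLp] with z hz
      rw [Pi.sub_apply, Pi.sub_apply, hz]
    · have h1 := tendsto_iff_edist_tendsto_0.1 hlim
      exact h1.congr fun j => Lp.edist_def _ _
  · obtain ⟨F, hFm, hF⟩ := hF
    refine ⟨F, hFm, ?_⟩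
    filter_upwards [hF, hfg] with ω h1 h2
    rwa [← h2]

end JointRep

/-- The filtration `ℱ k ⊗ 𝒯` on a product `Ω × T`. -/
def prodFiltration {Ω : Type*} {m0 : MeasurableSpace Ω} (ℱ : Filtration ℕ m0) {T : Type*}
    (mT : MeasurableSpace T) : Filtration ℕ (m0.prod mT) where
  seq k := (ℱ k).prod mT
  mono' _ _ h := sup_le_sup_right (MeasurableSpace.comap_mono (ℱ.mono h)) _
  le' k := sup_le_sup_right (MeasurableSpace.comap_mono (ℱ.le k)) _

section Bochner

variable {Ω T Z : Type*} {m0 : MeasurableSpace Ω} {mT : MeasurableSpace T} {P : Measure Ω}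
  [IsProbabilityMeasure P] {ν : Measure T} [IsProbabilityMeasure ν] [NormedAddCommGroup Z]
  [NormedSpace ℝ Z] [CompleteSpace Z] {r : ℝ≥0∞} [Fact (1 ≤ r)] {ℱ : Filtration ℕ m0}

/-- Integration over a measurable set, as a continuous linear map on `L_r` of a probability
space. -/
noncomputable def setIntegralCLM (ν : Measure T) [IsProbabilityMeasure ν] (r : ℝ≥0∞)
    [Fact (1 ≤ r)] (B : Set T) : Lp Z r ν →L[ℝ] Z :=
  LinearMap.mkContinuous
    { toFun := fun g => ∫ t in B, g t ∂ν
      map_add' := fun g h => by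
        have hi : ∀ g : Lp Z r ν, Integrable g (ν.restrict B) := fun g =>
          ((Lp.memLp g).integrable Fact.out).integrableOn
        rw [← integral_add (hi g) (hi h)]
        exact integral_congr_ae (ae_restrict_of_ae (Lp.coeFn_add g h))
      map_smul' := fun c g => by
        rw [RingHom.id_apply, ← integral_smul]
        exact integral_congr_ae (ae_restrict_of_ae (Lp.coeFn_smul c g)) } 1 fun g => by
    have hi : Integrable g ν := (Lp.memLp g).integrable Fact.out
    rw [one_mul]
    calc ‖∫ t in B, g t ∂ν‖ ≤ ∫ t in B, ‖g t‖ ∂ν := norm_integral_le_integral_norm _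
      _ ≤ ∫ t, ‖g t‖ ∂ν := setIntegral_le_integral hi.norm (ae_of_all _ fun _ => norm_nonneg _)
      _ = (eLpNorm g 1 ν).toReal := by
        rw [integral_norm_eq_lintegral_enorm hi.1, eLpNorm_one_eq_lintegral_enorm]
      _ ≤ (eLpNorm g r ν).toReal :=
        ENNReal.toReal_mono (Lp.eLpNorm_ne_top g)
          (eLpNorm_le_eLpNorm_of_exponent_le Fact.out hi.1)
      _ = ‖g‖ := (Lp.norm_def g).symm

/-- A jointly measurable representative of an `L_r(T; Z)`-valued martingale is a `Z`-valued
martingale on the product space. -/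
theorem IsJointRep.martingale (hr : 1 < r) (hr' : r < ∞) {f : ℕ → Ω → Lp Z r ν}
    (hf : Martingale f ℱ P) (hfr : ∀ k, MemLp (f k) r P) {F : ℕ → Ω × T → Z}
    (hFm : StronglyAdapted (prodFiltration ℱ mT) F) (hF : ∀ k, IsJointRep P (F k) (f k)) :
    Martingale F (prodFiltration ℱ mT) (P.prod ν) := by
  have hr0 : r ≠ 0 := by positivity
  have hint : ∀ k, Integrable (F k) (P.prod ν) := fun k =>
    ((hF k).memLp hr0 hr'.ne ((hFm k).mono ((prodFiltration ℱ mT).le k)).aestronglyMeasurable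
      (hfr k)).integrable hr.le
  have hrect : ∀ k (A : Set Ω) (B : Set T),
      ∫ z in A ×ˢ B, F k z ∂(P.prod ν) = setIntegralCLM ν r B (∫ ω in A, f k ω ∂P) := by
    intro k A B
    rw [setIntegral_prod _ (hint k).integrableOn,
      ← ContinuousLinearMap.integral_comp_comm _ (hf.integrable k).integrableOn]
    refine integral_congr_ae (ae_restrict_of_ae ?_)
    filter_upwards [hF k] with ω hω
    exact integral_congr_ae (ae_restrict_of_ae hω)
  refine martingale_of_setIntegral_eq_succ hFm hint fun k s hs => ?_
  have hle := (prodFiltration ℱ mT).le k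
  refine MeasurableSpace.induction_on_inter (m := (ℱ k).prod mT)
    (C := fun s _ => ∫ z in s, F k z ∂(P.prod ν) = ∫ z in s, F (k + 1) z ∂(P.prod ν))
    (@generateFrom_prod Ω T (ℱ k) mT).symm (@isPiSystem_prod Ω T (ℱ k) mT) ?_ ?_ ?_ ?_ s hs
  · simp
  · rintro _ ⟨A, hA, B, hB, rfl⟩
    rw [hrect, hrect, hf.setIntegral_eq k.le_succ hA]
  · intro t ht h
    have huniv : ∫ z, F k z ∂(P.prod ν) = ∫ z, F (k + 1) z ∂(P.prod ν) := by
      have h1 := hrect k Set.univ Set.univ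
      have h2 := hrect (k + 1) Set.univ Set.univ
      rw [Set.univ_prod_univ, setIntegral_univ] at h1 h2
      rw [h1, h2, hf.setIntegral_eq k.le_succ MeasurableSet.univ]
    rw [setIntegral_compl (hle t ht) (hint k), setIntegral_compl (hle t ht) (hint (k + 1)), h,
      huniv]
  · intro t hd ht h
    rw [integral_iUnion (fun i => hle _ (ht i)) hd (hint k).integrableOn,
      integral_iUnion (fun i => hle _ (ht i)) hd (hint (k + 1)).integrableOn]
    simp only [h]

end Bochner

/-- The `UMD_r` inequality passes from `Z` to `L_r(T; Z)`: an `L_r(T; Z)`-valued martingale on `Ω`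
is a `Z`-valued martingale on `Ω × T` with the same `L_r` norms. -/
theorem IsUMDBound.lp {T : Type} {mT : MeasurableSpace T} {ν : Measure T} [IsProbabilityMeasure ν]
    {Z : Type*} [NormedAddCommGroup Z] [NormedSpace ℝ Z] [CompleteSpace Z] {r : ℝ≥0∞}
    [Fact (1 ≤ r)] (hr : 1 < r) (hr' : r < ∞) {C : ℝ≥0∞} (hC : IsUMDBound r Z C) :
    IsUMDBound r (Lp Z r ν) C := by
  intro Ω m0 P _ ℱ f hf hfr n ε hε
  have hr0 : r ≠ 0 := by positivity
  have hex : ∀ k, ∃ F : Ω × T → Z, StronglyMeasurable[(ℱ k).prod mT] F ∧ IsJointRep P F (f k) := by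
    intro k
    have h1 : MemLp (f k) r (P.trim (ℱ.le k)) :=
      ⟨(hf.1 k).aestronglyMeasurable, by
        rw [eLpNorm_trim (ℱ.le k) (hf.1 k)]; exact (hfr k).2⟩
    obtain ⟨F, hFm, hF⟩ := @exists_isJointRep Ω T Z (ℱ k) mT (P.trim (ℱ.le k)) ν _ r _ _ _ _ hr hr'
      (f k) h1
    exact ⟨F, hFm, ae_of_ae_trim (ℱ.le k) hF⟩
  choose F hFm hF using hex
  have hmart : Martingale F (prodFiltration ℱ mT) (P.prod ν) :=
    IsJointRep.martingale hr hr' hf hfr hFm hF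
  have hFmem : ∀ k, MemLp (F k) r (P.prod ν) := fun k =>
    (hF k).memLp hr0 hr'.ne ((hFm k).mono ((prodFiltration ℱ mT).le k)).aestronglyMeasurable (hfr k)
  have h := hC (Ω × T) (m0.prod mT) (P.prod ν) inferInstance (prodFiltration ℱ mT) F hmart hFmem n
    ε hε
  simp only [sum_range_martingaleDiff] at h ⊢
  rw [(hF n).eLpNorm_eq hr0 hr'.ne (hFmem n).1] at h
  refine le_trans (le_of_eq ?_) h
  exact ((isJointRep_signTransform hF ε n).eLpNorm_eq hr0 hr'.ne
    (memLp_signTransform hFmem n).1).symm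

/-! ### Iterated spaces -/

section UMDConst

variable {X : Type*} [NormedAddCommGroup X] [NormedSpace ℝ X] [CompleteSpace X]

theorem IsUMDBound.umdConst_le {s C : ℝ≥0∞} (h : IsUMDBound s X C) : umdConst s X ≤ C :=
  sInf_le h

theorem umdConst_eq_zero_of_subsingleton [Subsingleton X] (s : ℝ≥0∞) : umdConst s X = 0 := by
  refine le_antisymm (IsUMDBound.umdConst_le ?_) zero_le
  intro Ω m0 P _ ℱ f _ _ n ε _
  have e : (fun ω => ∑ k ∈ Finset.range (n + 1), ε k • martingaleDiff f k ω) = 0 :=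
    Subsingleton.elim _ _
  rw [e, eLpNorm_zero]
  exact zero_le

/-- A constant martingale shows that the `UMD` constant of a nonzero space is at least `1`. -/
theorem IsUMDBound.one_le [Nontrivial X] {s C : ℝ≥0∞} (hs : 1 < s) (h : IsUMDBound s X C) :
    1 ≤ C := by
  obtain ⟨x, hx⟩ := exists_ne (0 : X)
  have h1 := h Unit ⊤ (Measure.dirac ()) inferInstance ⊤ (fun _ _ => x)
    (martingale_const _ _ x) (fun _ => memLp_const x) 0 (fun _ => 1) fun _ => Or.inl rfl
  have e : (fun ω : Unit => ∑ k ∈ Finset.range (0 + 1), martingaleDiff (fun _ _ => x) k ω)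
      = fun _ => x := by
    ext; simp [martingaleDiff]
  simp only [one_smul] at h1
  rw [e, eLpNorm_const x (by positivity) (IsProbabilityMeasure.ne_zero _), measure_univ,
    ENNReal.one_rpow, mul_one] at h1
  have hx0 : ‖x‖ₑ ≠ 0 := by simpa using hx
  nth_rw 1 [← one_mul ‖x‖ₑ] at h1
  exact (ENNReal.mul_le_mul_iff_left hx0 enorm_ne_top).1 h1

/-- Independence of the exponent: all the `UMD` constants of a space are comparable, linearly and
uniformly over all Banach spaces. -/
theorem umdConst_le_extrapolationConst_mul {r s : ℝ≥0∞} (hr : 1 < r) (hr' : r < ∞) (hs : 1 < s)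
    (hs' : s < ∞) : umdConst s X ≤ extrapolationConst s * umdConst r X := by
  rcases subsingleton_or_nontrivial X with hX | hX
  · rw [umdConst_eq_zero_of_subsingleton]; exact zero_le
  have h0 : extrapolationConst s ≠ 0 :=
    (zero_lt_one.trans_le (one_le_extrapolationConst hs hs')).ne'
  rw [umdConst.eq_def r X, sInf_eq_iInf', ENNReal.mul_iInf_of_ne h0 (extrapolationConst_ne_top s)]
  refine le_iInf ?_
  rintro ⟨C, hC⟩
  rcases eq_or_ne C ∞ with rfl | hCt
  · simp only
    rw [ENNReal.mul_top h0]; exact le_top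
  · lift C to ℝ≥0 using hCt
    exact (IsUMDBound.extrapolate hr hr' hs hs' (by exact_mod_cast hC.one_le hr) hC).umdConst_le

theorem umdConst_lp_le {T : Type} {mT : MeasurableSpace T} {ν : Measure T} [IsProbabilityMeasure ν]
    {r : ℝ≥0∞} [Fact (1 ≤ r)] (hr : 1 < r) (hr' : r < ∞) :
    umdConst r (Lp X r ν) ≤ umdConst r X :=
  le_sInf fun _ hC => (IsUMDBound.lp hr hr' hC).umdConst_le

theorem umdConst_piLp_le {ι : Type*} [Fintype ι] {r : ℝ≥0∞} [Fact (1 ≤ r)] (hr : 1 < r)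
    (hr' : r < ∞) : umdConst r (PiLp r fun _ : ι => X) ≤ umdConst r X :=
  le_sInf fun _ hC => (IsUMDBound.piLp hr hr' hC).umdConst_le

theorem umdConst_ne_top_of_innerProductSpace {H : Type*} [NormedAddCommGroup H]
    [InnerProductSpace ℝ H] [CompleteSpace H] {s : ℝ≥0∞} (hs : 1 < s) (hs' : s < ∞) :
    umdConst s H ≠ ∞ := by
  have h1 : umdConst s H ≤ extrapolationConst s * 1 :=
    (umdConst_le_extrapolationConst_mul (by norm_num) (by norm_num) hs hs').trans
      (mul_le_mul_right isUMDBound_two_of_innerProductSpace.umdConst_le _)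
  exact (h1.trans_lt (by simpa using (extrapolationConst_ne_top s).lt_top)).ne

end UMDConst

/-- If `Φ_p` and `Φ_q` do not increase the `UMD_p` and the `UMD_q` constant respectively, then
`Φ_p ∘ Φ_q` increases the `UMD_s` constant at most by a factor depending only on `p`, `q`, `s`. -/
theorem umd_comp_le {p q s : ℝ≥0∞} (hp : 1 < p) (hp' : p < ∞) (hq : 1 < q) (hq' : q < ∞)
    (hs : 1 < s) (hs' : s < ∞) (Z Zq Zpq : BanachSp.{u}) (h1 : Zq.umd q ≤ Z.umd q)
    (h2 : Zpq.umd p ≤ Zq.umd p) :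
    Zpq.umd s ≤ extrapolationConst s * extrapolationConst p * extrapolationConst q * Z.umd s :=
  calc Zpq.umd s ≤ extrapolationConst s * Zpq.umd p :=
        umdConst_le_extrapolationConst_mul hp hp' hs hs'
    _ ≤ extrapolationConst s * (extrapolationConst p * Zq.umd q) := by
        gcongr
        exact h2.trans (umdConst_le_extrapolationConst_mul hq hq' hp hp')
    _ ≤ extrapolationConst s * (extrapolationConst p * (extrapolationConst q * Z.umd s)) := by
        gcongr
        exact h1.trans (umdConst_le_extrapolationConst_mul hs hs' hq hq')
    _ = _ := by ring

theorem umd_iterLp_le {p q s : ℝ≥0∞} [Fact (1 ≤ p)] [Fact (1 ≤ q)] (hp : 1 < p) (hp' : p < ∞)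
    (hq : 1 < q) (hq' : q < ∞) (hs : 1 < s) (hs' : s < ∞) (Z : BanachSp.{u}) (n : ℕ) :
    (iterLp p q Z n).umd s
      ≤ (extrapolationConst s * extrapolationConst p * extrapolationConst q) ^ n * Z.umd s := by
  induction n with
  | zero => simp [iterLp]
  | succ n ih =>
    rw [pow_succ', mul_assoc]
    refine (umd_comp_le hp hp' hq hq' hs hs' (iterLp p q Z n) ((iterLp p q Z n).LpCircle q)
      (iterLp p q Z (n + 1)) (umdConst_lp_le hq hq') (umdConst_lp_le hp hp')).trans ?_
    gcongr

theorem umd_iterEll_le {p q s : ℝ≥0∞} [Fact (1 ≤ p)] [Fact (1 ≤ q)] (hp : 1 < p) (hp' : p < ∞)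
    (hq : 1 < q) (hq' : q < ∞) (hs : 1 < s) (hs' : s < ∞) (Z : BanachSp.{u}) (n : ℕ) :
    (iterEll p q Z n).umd s
      ≤ (extrapolationConst s * extrapolationConst p * extrapolationConst q) ^ n * Z.umd s := by
  induction n with
  | zero => simp [iterEll]
  | succ n ih =>
    rw [pow_succ', mul_assoc]
    refine (umd_comp_le hp hp' hq hq' hs hs' (iterEll p q Z n) ((iterEll p q Z n).ellTwo q)
      (iterEll p q Z (n + 1)) (umdConst_piLp_le hq hq') (umdConst_piLp_le hp hp')).trans ?_
    gcongr

theorem mainTheorem6 (p q s : ℝ≥0∞) [Fact (1 ≤ p)] [Fact (1 ≤ q)]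
    (hp : 1 < p) (hp' : p < ∞) (hq : 1 < q) (hq' : q < ∞) (hpq : p ≠ q)
    (hs : 1 < s) (hs' : s < ∞) :
    ∃ χ : ℝ≥0,
      (∀ (X : Type u) [NormedAddCommGroup X] [NormedSpace ℝ X] [CompleteSpace X] (n : ℕ),
        (iterLp p q ⟨X⟩ n).umd s ≤ (χ : ℝ≥0∞) ^ n * umdConst s X) ∧
      (∀ n : ℕ, 1 ≤ n →
        (iterEll p q ⟨ℝ⟩ n).umd s ≤ (χ : ℝ≥0∞) ^ n ∧
        (iterEll p q ⟨ℂ⟩ n).umd s ≤ (χ : ℝ≥0∞) ^ n) := by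
  set χ₀ : ℝ≥0∞ := extrapolationConst s * extrapolationConst p * extrapolationConst q with hχ₀
  -- The factor `K` absorbs the `UMD_s` constants of the scalar fields.
  set K : ℝ≥0∞ := max 1 (max (umdConst s ℝ) (umdConst s ℂ)) with hK
  have hKR : umdConst s ℝ ≤ K := (le_max_left _ _).trans (le_max_right _ _)
  have hKC : umdConst s ℂ ≤ K := (le_max_right _ _).trans (le_max_right _ _)
  have hK1 : 1 ≤ K := le_max_left _ _
  have hχ₀t : χ₀ ≠ ∞ := ENNReal.mul_ne_top (ENNReal.mul_ne_top (extrapolationConst_ne_top s)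
    (extrapolationConst_ne_top p)) (extrapolationConst_ne_top q)
  have hKt : K ≠ ∞ := (max_lt ENNReal.one_lt_top
    (max_lt (umdConst_ne_top_of_innerProductSpace hs hs').lt_top
      (umdConst_ne_top_of_innerProductSpace hs hs').lt_top)).ne
  refine ⟨(χ₀ * K).toNNReal, fun X _ _ _ n => ?_, fun n hn => ?_⟩ <;>
    rw [ENNReal.coe_toNNReal (ENNReal.mul_ne_top hχ₀t hKt)]
  · refine (umd_iterLp_le hp hp' hq hq' hs hs' ⟨X⟩ n).trans ?_
    refine mul_le_mul' (pow_le_pow_left' ?_ n) le_rfl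
    exact le_mul_of_one_le_right' hK1
  · have hpow : ∀ c ≤ K, χ₀ ^ n * c ≤ (χ₀ * K) ^ n := fun c hc => by
      rw [mul_pow χ₀ K n]
      exact mul_le_mul' le_rfl (hc.trans (le_self_pow₀ hK1 (Nat.one_le_iff_ne_zero.1 hn)))
    exact ⟨(umd_iterEll_le hp hp' hq hq' hs hs' ⟨ℝ⟩ n).trans (hpow _ hKR),
      (umd_iterEll_le hp hp' hq hq' hs hs' ⟨ℂ⟩ n).trans (hpow _ hKC)⟩
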